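/- Let $\mathcal G$ be the ultragraph of the Renewal shift matrix: it has vertices $v_1,v_2,\dots$ and edges $e,f_1,f_2,\dots$ with $s(e)=v_1$, $r(e)=\{v_i:i\ge 1\}$, $s(f_i)=v_{i+1}$, $r(f_i)=\{v_i\}$. Let $\mathcal G^0$ be the smallest family of vertex sets that contains all $\{v\}$ and all ranges of edges and is closed under finite unions and non-empty finite intersections. For a set $A$ of vertices let $\varepsilon(A)$ be the set of edges with source in $A$; a minimal infinite emitter is an $A\in\mathcal G^0$ with $\varepsilon(A)$ infinite that has no proper subset $B\in\mathcal G^0$ with $\varepsilon(B)$ infinite. An ultrapath is a pair $(\alpha,A)$, where $\alpha$ is a finite path (a sequence of edges $e_1\dots e_k$ with $s(e_{i+1})\in r(e_i)$), $A\in\mathcal G^0$, and $A\subseteq r(\alpha):=r(e_k)$ if $k\ge 1$; if $k=0$ we also write $(A,A)$. Let $X$ be the set of all infinite paths together with all ultrapaths $(\alpha,A)$ such that $A$ is a minimal infinite emitter. Put $$D_{(\beta,B)}=\{(\beta,A)\in X:A\subseteq B\}\cup\{\beta\gamma'\in X:|\gamma'|\ge 1,\ s(\gamma')\in B\},$$ $$D_{(\beta,B),F}=\{(\beta,B)\}\cup\{\beta\gamma'\in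 X:|\gamma'|\ge1,\ \gamma'_1\in\varepsilon(B)\setminus F\},$$ and give $X$ the topology generated by the sets $D_{(\beta,B)}$, for $(\beta,B)$ an ultrapath with $|\beta|\ge1$, and $D_{(\beta,B),F}$, for $(\beta,B)\in X$ and $F\subseteq\varepsilon(B)$ finite. Let $\sigma$ be the shift map, which deletes the first edge and is defined on the points of length at least one, with $\sigma(\gamma_1,A)=(A,A)$. For a set $\alpha$ of subsets of $X$ covering $Y\subseteq X$, let $N(\alpha,Y)$ be the least cardinality of a subcover (with $N(\alpha,\emptyset)=1$), let $\alpha_n=\alpha\vee\sigma^{-1}(\alpha)\vee\dots\vee\sigma^{-n}(\alpha)$ and $Y_n=Y\cap\sigma^{-1}(Y)\cap\dots\cap\sigma^{-n}(Y)$. For $K$ compact and $\alpha$ an open cover of $K$ let $h(\alpha,\sigma,K)=\lim_{n\to\infty}\frac1n\log N(\alpha_n,K_n)$; let $h(\sigma,K)=\sup_\alpha h(\alpha,\sigma,K)$ over all open covers $\alpha$ of $K$, and let the topological entropy be $h(\sigma)=\sup_K h(\sigma,K)$ over all compact $K\subseteq X$. Then $X$ is compact, $(X,\sigma)$ is a Deaconu–Renault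 system (that is, $X$ is locally compact Hausdorff and $\sigma$ is a local homeomorphism from an open subset of $X$ onto an open subset of $X$), and $$h(\sigma)=h(\sigma,X)=\log 2 .$$ Moreover, for $m\ge1$ let $F=\{e,f_1,\dots,f_m\}$, let $Q$ be the set of finite paths $\beta$ of positive length less than $m$ with edges in $F$ and last edge $e$, let $R$ be the set of paths of length $m$ with edges in $F$, and put $$\alpha^m=\{D_{(r(e),r(e)),F}\}\cup\{D_{(\beta,r(\beta)),F}:\beta\in Q\}\cup\{D_{(\gamma,r(\gamma))}:\gamma\in R\}.$$ Then $\alpha^m$ is a finite open cover of $X$ by pairwise disjoint sets, $N(\alpha^m_n,X_n)=2^n|\alpha^m|$ for all $n\ge0$, and $h(\alpha^m,\sigma,X)=\log2$. Finally, let $p_1,p_2,\dots$ be an enumeration without repetition of all ultrapaths, or of those ultrapaths $(\alpha,A)$ for which $A$ is a single vertex or a minimal infinite emitter. Put $d(x,x)=0$ and, for $x\ne y$, $d(x,y)=2^{-i}$ with $i$ the least index such that exactly one of $x,y$ has $p_i$ as an initial segment, where $x\in X$ has $(\beta,B)$ as an initial segment if $x=(\beta,A)$ with $A\subseteq B$,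 or $x=\beta\gamma'$ with $|\gamma'|\ge1$ and $s(\gamma')\in B$. Then $d$ is a metric on $X$ that induces its topology, and $\operatorname{diam}(\alpha^m)=\sup_{A\in\alpha^m}\operatorname{diam}(A)\to0$ as $m\to\infty$. -/

import Mathlib

open Set Filter Topology

/-! ## Deaconu-Renault systems and entropy via open covers -/

namespace DRSystem

/-- `(X, σ)` is a Deaconu-Renault system: `X` is a locally compact Hausdorff space and the partial
map `σ` is a local homeomorphism from the open set `Dom σ` onto an open subset of `X`
(the image of a local homeomorphism into `X` is automatically open). -/
structure IsDeaconuRenault {X : Type*} [TopologicalSpace X] (σ : X →. X) : Prop where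
  locallyCompact : LocallyCompactSpace X
  hausdorff : T2Space X
  isOpen_dom : IsOpen σ.Dom
  isLocalHomeomorph : IsLocalHomeomorph σ.asSubtype

/-- `α` is a cover of `Y` by open subsets of `X`. -/
def IsOpenCover {X : Type*} [TopologicalSpace X] (α : Set (Set X)) (Y : Set X) : Prop :=
  (∀ A ∈ α, IsOpen A) ∧ Y ⊆ ⋃₀ α

/-- The join `α ∨ β`: all the intersections `A ∩ B` with `A ∈ α`, `B ∈ β`. -/
def join {X : Type*} (α β : Set (Set X)) : Set (Set X) := Set.image2 (· ∩ ·) α β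

/-- The preimage `σ⁻ⁱ(A)`; it consists of points of `Dom (σⁱ)`. -/
def preim {X : Type*} (σ : X →. X) (i : ℕ) (A : Set X) : Set X := σ.preimage^[i] A

/-- `σ⁻ⁱ(α) = {σ⁻ⁱ(A) : A ∈ α}`. -/
def preimCover {X : Type*} (σ : X →. X) (i : ℕ) (α : Set (Set X)) : Set (Set X) :=
  preim σ i '' α

/-- `α_n = α ∨ σ⁻¹(α) ∨ ⋯ ∨ σ⁻ⁿ(α)`. -/
def iterJoin {X : Type*} (σ : X →. X) (α : Set (Set X)) : ℕ → Set (Set X)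
  | 0 => α
  | n + 1 => join (iterJoin σ α n) (preimCover σ (n + 1) α)

/-- `Y_n = Y ∩ σ⁻¹(Y) ∩ ⋯ ∩ σ⁻ⁿ(Y)`. -/
def iterSet {X : Type*} (σ : X →. X) (Y : Set X) : ℕ → Set X
  | 0 => Y
  | n + 1 => iterSet σ Y n ∩ preim σ (n + 1) Y

/-- `N(α, Y)`: the smallest cardinality of a subfamily of `α` that covers `Y`, with value `∞` if no
finite subfamily does. For `Y = ∅` the convention is `N(α, ∅) = 1`; this is all that `max 1` does,
since a family that covers a non-empty set has at least one member. -/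
noncomputable def coverNumber {X : Type*} (α : Set (Set X)) (Y : Set X) : ℕ∞ :=
  max 1 (⨅ (γ : Set (Set X)) (_ : γ ⊆ α ∧ Y ⊆ ⋃₀ γ), γ.encard)

/-- `H(α, Y) = log N(α, Y)`, with value `∞` if `N(α, Y) = ∞`. -/
noncomputable def coverLog {X : Type*} (α : Set (Set X)) (Y : Set X) : EReal :=
  ENNReal.log (coverNumber α Y : ENNReal)

/-- `h(α, σ, K) = lim (1/n) H(α_n, K_n)`. It is written as an upper limit, so that no existence
statement is needed for the definition; the limit does exist whenever `α` is an open cover of a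
compact `K`, see `tendsto_coverEntropy` below. -/
noncomputable def coverEntropy {X : Type*} (α : Set (Set X)) (σ : X →. X) (K : Set X) : EReal :=
  limsup (fun n : ℕ => coverLog (iterJoin σ α n) (iterSet σ K n) / (n : EReal)) atTop

/-- `h(σ, K)`: the supremum of `h(α, σ, K)` over the open covers `α` of `K`. -/
noncomputable def relEntropy {X : Type*} [TopologicalSpace X] (σ : X →. X) (K : Set X) : EReal :=
  ⨆ (α : Set (Set X)) (_ : IsOpenCover α K), coverEntropy α σ K

/-- The topological entropy `h(σ)`: the supremum of `h(σ, K)` over the compact sets `K`. -/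
noncomputable def topEntropy {X : Type*} [TopologicalSpace X] (σ : X →. X) : EReal :=
  ⨆ (K : Set X) (_ : IsCompact K), relEntropy σ K

/-- The diameter of a family of sets with respect to a distance function `d`. -/
noncomputable def coverDiam {X : Type*} (d : X → X → ℝ) (α : Set (Set X)) : ENNReal :=
  ⨆ A ∈ α, ⨆ x ∈ A, ⨆ y ∈ A, ENNReal.ofReal (d x y)

/-! ### Existence of the limit defining `coverEntropy` -/

theorem preim_add {X : Type*} (σ : X →. X) (i j : ℕ) (A : Set X) :
    preim σ (i + j) A = preim σ i (preim σ j A) :=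
  Function.iterate_add_apply _ _ _ _

theorem preim_inter {X : Type*} (σ : X →. X) (i : ℕ) (A B : Set X) :
    preim σ i (A ∩ B) = preim σ i A ∩ preim σ i B := by
  induction i generalizing A B with
  | zero => rfl
  | succ i ih =>
    have h1 : σ.preimage (A ∩ B) = σ.preimage A ∩ σ.preimage B := by
      refine Subset.antisymm (σ.preimage_inter A B) ?_
      rintro x ⟨hA, hB⟩
      rw [PFun.mem_preimage] at hA hB ⊢
      obtain ⟨y, hy, hxy⟩ := hA
      obtain ⟨z, hz, hxz⟩ := hB
      obtain rfl := Part.mem_unique hxy hxz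
      exact ⟨y, ⟨hy, hz⟩, hxy⟩
    show preim σ i (σ.preimage (A ∩ B)) = preim σ i (σ.preimage A) ∩ preim σ i (σ.preimage B)
    rw [h1, ih]

theorem preim_mono {X : Type*} (σ : X →. X) (i : ℕ) {A B : Set X} (h : A ⊆ B) :
    preim σ i A ⊆ preim σ i B := by
  induction i generalizing A B with
  | zero => exact h
  | succ i ih => exact ih (σ.preimage_mono h)

theorem preim_sUnion {X : Type*} (σ : X →. X) (i : ℕ) (γ : Set (Set X)) :
    preim σ i (⋃₀ γ) ⊆ ⋃₀ (preim σ i '' γ) := by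
  induction i generalizing γ with
  | zero =>
    show ⋃₀ γ ⊆ ⋃₀ ((fun A => A) '' γ)
    rw [image_id']
  | succ i ih =>
    have h1 : σ.preimage (⋃₀ γ) ⊆ ⋃₀ (σ.preimage '' γ) := by
      intro x hx
      rw [PFun.mem_preimage] at hx
      obtain ⟨y, ⟨A, hA, hy⟩, hxy⟩ := hx
      exact ⟨_, ⟨A, hA, rfl⟩, (PFun.mem_preimage _ _ _).2 ⟨y, hy, hxy⟩⟩
    refine (preim_mono σ i h1).trans ((ih _).trans ?_)
    rw [image_image]
    exact subset_rfl

theorem iterJoin_add {X : Type*} (σ : X →. X) (α : Set (Set X)) (n m : ℕ) {A B : Set X}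
    (hA : A ∈ iterJoin σ α n) (hB : B ∈ iterJoin σ α m) :
    A ∩ preim σ (n + 1) B ∈ iterJoin σ α (n + m + 1) := by
  induction m generalizing B with
  | zero => exact ⟨A, hA, _, ⟨B, hB, rfl⟩, rfl⟩
  | succ m ih =>
    obtain ⟨B', hB', _, ⟨C, hC, rfl⟩, rfl⟩ := hB
    refine ⟨_, ih hB', _, ⟨C, hC, rfl⟩, ?_⟩
    simp only [preim_inter, ← preim_add]
    rw [inter_assoc, show n + (m + 1) + 1 = n + 1 + (m + 1) by omega]

theorem iterSet_add {X : Type*} (σ : X →. X) (Y : Set X) (n m : ℕ) :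
    iterSet σ Y (n + m + 1) = iterSet σ Y n ∩ preim σ (n + 1) (iterSet σ Y m) := by
  induction m with
  | zero => rfl
  | succ m ih =>
    show iterSet σ Y (n + m + 1) ∩ preim σ (n + m + 1 + 1) Y = _
    rw [ih]
    simp only [iterSet, preim_inter, ← preim_add]
    rw [inter_assoc, show n + m + 1 + 1 = n + 1 + (m + 1) by omega]

theorem coverNumber_iterJoin_add {X : Type*} (σ : X →. X) (α : Set (Set X)) (Y : Set X)
    (n m : ℕ) :
    coverNumber (iterJoin σ α (n + m + 1)) (iterSet σ Y (n + m + 1)) ≤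
      coverNumber (iterJoin σ α n) (iterSet σ Y n) *
        coverNumber (iterJoin σ α m) (iterSet σ Y m) := by
  have key : ∀ (α' : Set (Set X)) (Y' : Set X), coverNumber α' Y' ≠ ⊤ →
      ∃ γ : Set (Set X), γ ⊆ α' ∧ Y' ⊆ ⋃₀ γ ∧ γ.encard ≤ coverNumber α' Y' := by
    intro α' Y' h
    have hlt : (⨅ (γ : Set (Set X)) (_ : γ ⊆ α' ∧ Y' ⊆ ⋃₀ γ), γ.encard) <
        coverNumber α' Y' + 1 :=
      lt_of_le_of_lt (le_max_right _ _) ((ENat.lt_add_one_iff h).2 le_rfl)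
    simp only [iInf_lt_iff] at hlt
    obtain ⟨γ, hγ, hl⟩ := hlt
    exact ⟨γ, hγ.1, hγ.2, (ENat.lt_add_one_iff h).1 hl⟩
  have pos : ∀ (α' : Set (Set X)) (Y' : Set X), 1 ≤ coverNumber α' Y' :=
    fun α' Y' => le_max_left _ _
  by_cases h1 : coverNumber (iterJoin σ α n) (iterSet σ Y n) = ⊤
  · rw [h1, ENat.top_mul (ne_of_gt (lt_of_lt_of_le zero_lt_one (pos _ _)))]
    exact le_top
  by_cases h2 : coverNumber (iterJoin σ α m) (iterSet σ Y m) = ⊤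
  · rw [h2, ENat.mul_top (ne_of_gt (lt_of_lt_of_le zero_lt_one (pos _ _)))]
    exact le_top
  obtain ⟨γ, hγ, hγc, hγn⟩ := key _ _ h1
  obtain ⟨δ, hδ, hδc, hδn⟩ := key _ _ h2
  refine max_le (one_le_mul (pos _ _) (pos _ _)) ?_
  refine (iInf₂_le ((fun q : Set X × Set X => q.1 ∩ preim σ (n + 1) q.2) '' (γ ×ˢ δ))
    ⟨?cc, ?dd⟩).trans ((encard_image_le _ _).trans ?ee)
  case cc =>
    rintro _ ⟨⟨A, B⟩, ⟨hA, hB⟩, rfl⟩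
    exact iterJoin_add σ α n m (hγ hA) (hδ hB)
  case dd =>
    rw [iterSet_add]
    rintro x ⟨hx, hx'⟩
    obtain ⟨A, hA, hxA⟩ := hγc hx
    obtain ⟨_, ⟨B, hB, rfl⟩, hxB⟩ := preim_sUnion σ (n + 1) δ (preim_mono σ (n + 1) hδc hx')
    exact ⟨_, ⟨(A, B), ⟨hA, hB⟩, rfl⟩, hxA, hxB⟩
  case ee =>
    rw [encard_prod]
    exact mul_le_mul' hγn hδn

theorem coverNumber_iterJoin_ne_top {X : Type*} (σ : X →. X) (α : Set (Set X)) (Y : Set X)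
    (h : coverNumber α Y ≠ ⊤) (n : ℕ) :
    coverNumber (iterJoin σ α n) (iterSet σ Y n) ≠ ⊤ := by
  induction n with
  | zero => exact h
  | succ n ih =>
    exact ne_top_of_le_ne_top (WithTop.mul_ne_top ih h) (coverNumber_iterJoin_add σ α Y n 0)

theorem coverNumber_ne_top {X : Type*} [TopologicalSpace X] {α : Set (Set X)} {K : Set X}
    (hK : IsCompact K) (hα : IsOpenCover α K) : coverNumber α K ≠ ⊤ := by
  obtain ⟨γ, hγ, hc⟩ := hK.elim_finite_subcover_image (b := α) (c := id)
    (fun A hA => hα.1 A hA) (by simpa [sUnion_eq_biUnion] using hα.2)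
  refine ne_of_lt (max_lt (by simp) (lt_of_le_of_lt (iInf₂_le γ ⟨hγ, ?_⟩) hc.1.encard_lt_top))
  simpa [sUnion_eq_biUnion] using hc.2

/-- The limit `lim (1/n) H(α_n, K_n)` exists, hence equals `h(α, σ, K)`. -/
theorem tendsto_coverEntropy {X : Type*} [TopologicalSpace X] (σ : X →. X) {α : Set (Set X)}
    {K : Set X} (hK : IsCompact K) (hα : IsOpenCover α K) :
    Tendsto (fun n : ℕ => coverLog (iterJoin σ α n) (iterSet σ K n) / (n : EReal)) atTop
      (𝓝 (coverEntropy α σ K)) := by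
  have hfin := coverNumber_iterJoin_ne_top σ α K (coverNumber_ne_top hK hα)
  choose c hc using fun n => ENat.ne_top_iff_exists.1 (hfin n)
  have hc1 : ∀ n, 1 ≤ c n := fun n => by
    have : (1 : ℕ∞) ≤ (c n : ℕ∞) := (hc n).symm ▸ le_max_left _ _
    exact_mod_cast this
  have hmul : ∀ n m, c (n + m + 1) ≤ c n * c m := fun n m => by
    have := coverNumber_iterJoin_add σ α K n m
    rw [← hc, ← hc, ← hc] at this
    exact_mod_cast this
  have hlog : ∀ n, coverLog (iterJoin σ α n) (iterSet σ K n) / (n : EReal) =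
      ((Real.log (c n) / n : ℝ) : EReal) := fun n => by
    have h1 : (0 : ℝ) < c n := by exact_mod_cast hc1 n
    have h2 : ((c n : ℕ∞) : ENNReal) = ENNReal.ofReal (c n : ℝ) := by simp
    rw [coverLog, ← hc, h2, ENNReal.log_ofReal_of_pos h1, EReal.coe_div]
    rfl
  let u : ℕ → ℝ := fun n => Nat.casesOn n 0 fun k => Real.log (c k)
  have hu0 : ∀ n, 0 ≤ u n := fun n => by
    cases n with
    | zero => exact le_rfl
    | succ k => exact Real.log_natCast_nonneg _
  have hu : Subadditive u := by
    intro a b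
    cases a with
    | zero => simp [u]
    | succ a =>
      cases b with
      | zero => simp [u]
      | succ b =>
        have e : a + 1 + (b + 1) = a + b + 1 + 1 := by omega
        rw [e]
        have ha : (0 : ℝ) < c a := by exact_mod_cast hc1 a
        have hb : (0 : ℝ) < c b := by exact_mod_cast hc1 b
        show Real.log (c (a + b + 1)) ≤ Real.log (c a) + Real.log (c b)
        rw [← Real.log_mul ha.ne' hb.ne']
        exact Real.log_le_log (by exact_mod_cast hc1 _) (by exact_mod_cast hmul a b)
  have hlim := hu.tendsto_lim ⟨0, by rintro _ ⟨n, rfl⟩; exact div_nonneg (hu0 n) n.cast_nonneg⟩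
  have h2 : Tendsto (fun n : ℕ => Real.log (c n) / n) atTop (𝓝 hu.lim) := by
    have h3 := (hlim.comp (tendsto_add_atTop_nat 1)).mul
      (tendsto_const_nhds (x := (1 : ℝ)).add tendsto_one_div_atTop_nhds_zero_nat)
    rw [add_zero, mul_one] at h3
    refine h3.congr' ((eventually_ne_atTop 0).mono fun n hn => ?_)
    have hn' : (n : ℝ) ≠ 0 := by exact_mod_cast hn
    have hn1 : (n : ℝ) + 1 ≠ 0 := by positivity
    show Real.log (c n) / ((n + 1 : ℕ) : ℝ) * (1 + 1 / (n : ℝ)) = _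
    push_cast
    field_simp
  have h4 : Tendsto (fun n : ℕ => coverLog (iterJoin σ α n) (iterSet σ K n) / (n : EReal)) atTop
      (𝓝 ((hu.lim : ℝ) : EReal)) := by
    simp only [hlog]
    exact (continuous_coe_real_ereal.tendsto _).comp h2
  rw [coverEntropy, h4.limsup_eq]
  exact h4

end DRSystem

/-! ## Ultragraphs and their shift spaces -/

/-- An ultragraph with countable vertex set `V` and countable edge set `E`. -/
structure Ultragraph (V E : Type*) [Countable V] [Countable E] where
  /-- the source of an edge -/
  s : E → V
  /-- the range of an edge, a non-empty set of vertices -/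
  r : E → Set V
  r_nonempty : ∀ e, (r e).Nonempty

namespace Ultragraph

variable {V E : Type*} [Countable V] [Countable E] (G : Ultragraph V E)

/-- The family `𝒢⁰`: the smallest family of vertex sets that contains all singletons and all ranges
of edges and is closed under finite unions and non-empty finite intersections. -/
inductive GenSet (G : Ultragraph V E) : Set V → Prop
  | vertex (v : V) : GenSet G {v}
  | range (e : E) : GenSet G (G.r e)
  | union {A B : Set V} : GenSet G A → GenSet G B → GenSet G (A ∪ B)
  | inter {A B : Set V} : GenSet G A → GenSet G B → (A ∩ B).Nonempty → GenSet G (A ∩ B)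

/-- `ε(A)`: the edges whose source lies in `A`. -/
def emitted (A : Set V) : Set E := {e | G.s e ∈ A}

/-- `A` is a minimal infinite emitter: `A ∈ 𝒢⁰`, `ε(A)` is infinite, and `ε(B)` is finite for all
proper subsets `B` of `A` that belong to `𝒢⁰`. -/
def IsMinInfEmitter (A : Set V) : Prop :=
  G.GenSet A ∧ (G.emitted A).Infinite ∧ ∀ B, G.GenSet B → B ⊂ A → ¬ (G.emitted B).Infinite

/-- The list `e₁ … e_k` satisfies `s(e_{i+1}) ∈ r(e_i)` for all `i`. A finite path of positive
length is a non-empty such list. -/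
def IsPath (l : List E) : Prop := l.IsChain fun e e' => G.s e' ∈ G.r e

/-- The ultrapath space `𝔭`: pairs `(α, A)` with `α` a finite path and `A ∈ 𝒢⁰`, `A ⊆ r(α)`.
An ultrapath `(A, A)` of length zero is represented by the empty list together with `A`. -/
structure Ultrapath (G : Ultragraph V E) where
  edges : List E
  rng : Set V
  isPath : G.IsPath edges
  genSet : G.GenSet rng
  rng_subset : ∀ e ∈ edges.getLast?, rng ⊆ G.r e

/-- The points of `X = 𝔭^∞ ∪ X_fin`: infinite paths, and ultrapaths `(α, A)` where `A` is a minimal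
infinite emitter (contained in `r(α)` if `|α| ≥ 1`). -/
inductive ShiftSpace (G : Ultragraph V E)
  | inf (γ : ℕ → E) (h : ∀ i, G.s (γ (i + 1)) ∈ G.r (γ i))
  | fin (p : G.Ultrapath) (h : G.IsMinInfEmitter p.rng)

variable {G}

/-- The `i`-th edge of a point of `X` (counted from `0`), if it exists. -/
def ShiftSpace.edge? : G.ShiftSpace → ℕ → Option E
  | .inf γ _, i => some (γ i)
  | .fin p _, i => p.edges[i]?

/-- The sequence of edges of `x` starts with `β`. -/
def ShiftSpace.StartsWith (x : G.ShiftSpace) (β : List E) : Prop :=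
  ∀ i < β.length, x.edge? i = β[i]?

variable (G)

/-- `D_{(β,B)} = {(β, A) ∈ X : A ⊆ B} ∪ {y ∈ X : y = βγ', s(γ') ∈ B}`. -/
def cyl (β : List E) (B : Set V) : Set G.ShiftSpace :=
  {x | ∃ p h, x = .fin p h ∧ p.edges = β ∧ p.rng ⊆ B} ∪
  {x | ∃ e, x.StartsWith (β ++ [e]) ∧ G.s e ∈ B}

/-- `D_{(β,B),F} = {(β, B)} ∪ {y ∈ X : y = βγ', γ'₁ ∈ ε(B) ∖ F}`. -/
def cylDiff (β : List E) (B : Set V) (F : Set E) : Set G.ShiftSpace :=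
  {x | ∃ p h, x = .fin p h ∧ p.edges = β ∧ p.rng = B} ∪
  {x | ∃ e, x.StartsWith (β ++ [e]) ∧ e ∈ G.emitted B \ F}

/-- The topology of `X`, generated by the sets `D_{(β,B)}` with `(β,B) ∈ 𝔭`, `|β| ≥ 1`, and
`D_{(β,B),F}` with `(β,B) ∈ X_fin` and `F ⊆ ε(B)` finite. -/
instance shiftTopology : TopologicalSpace G.ShiftSpace :=
  TopologicalSpace.generateFrom
    ({D | ∃ p : G.Ultrapath, p.edges ≠ [] ∧ D = G.cyl p.edges p.rng} ∪
     {D | ∃ (p : G.Ultrapath) (F : Set E), G.IsMinInfEmitter p.rng ∧ F ⊆ G.emitted p.rng ∧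
        F.Finite ∧ D = G.cylDiff p.edges p.rng F})

variable {G}

/-- Removal of the first edge of an ultrapath: `(γ₁γ₂…γ_n, A) ↦ (γ₂…γ_n, A)`, and
`(γ₁, A) ↦ (A, A)`. -/
def Ultrapath.tail (p : G.Ultrapath) : G.Ultrapath where
  edges := p.edges.tail
  rng := p.rng
  isPath := p.isPath.tail
  genSet := p.genSet
  rng_subset := by
    intro e he
    refine p.rng_subset e ?_
    cases hl : p.edges with
    | nil => simp [hl] at he
    | cons a l =>
      cases l with
      | nil => simp [hl] at he
      | cons b l => simpa [hl, List.getLast?_cons_cons] using he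

variable (G)

/-- The shift map `σ : X ⇀ X`, defined at the points of length at least one. -/
def shift : G.ShiftSpace →. G.ShiftSpace
  | .inf γ h => Part.some (.inf (fun i => γ (i + 1)) fun i => h (i + 1))
  | .fin p h => ⟨p.edges ≠ [], fun _ => .fin p.tail h⟩

variable {G}

/-- The ultrapath `p = (β, B)` is an initial segment of `x`: either `x = (β, A)` with `A ⊆ B`, or
`x = βγ'` with `s(γ') ∈ B`. -/
def Ultrapath.IsInitialSegment (p : G.Ultrapath) (x : G.ShiftSpace) : Prop :=
  x ∈ G.cyl p.edges p.rng

open scoped Classical in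
/-- The distance on `X` associated with a list `p 0, p 1, …` of ultrapaths: `d(x, x) = 0`, and for
`x ≠ y`, `d(x, y) = 2^{-(i+1)}` where `i` is the smallest index such that `p i` is an initial
segment of exactly one of `x` and `y`. -/
noncomputable def pathDist (p : ℕ → G.Ultrapath) (x y : G.ShiftSpace) : ℝ :=
  if x = y then 0
  else (1 / 2) ^ (sInf {i | Xor ((p i).IsInitialSegment x) ((p i).IsInitialSegment y)} + 1)

variable (G)

/-- The set `S` of all ultrapaths `(α, A)` with `A` a vertex or a minimal infinite emitter. -/
def basicUltrapaths : Set G.Ultrapath :=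
  {p | (∃ v, p.rng = {v}) ∨ G.IsMinInfEmitter p.rng}

/-- The ultragraph associated with a `{0,1}`-matrix without zero rows: one vertex `v_i` and one edge
`e_i` for each index, `s(e_i) = v_i` and `r(e_i) = {v_j : A_{ij} = 1}`. -/
def ofMatrix {I : Type*} [Countable I] (A : I → I → ℕ) (hA : ∀ i, ∃ j, A i j = 1) :
    Ultragraph I I where
  s := id
  r i := {j | A i j = 1}
  r_nonempty := hA

end Ultragraph

/-! ## The Renewal shift -/

namespace Renewal

/-- The matrix of the Renewal shift, with rows and columns numbered from `0`: the first row
consists of ones, and the only non-zero entry of row `i + 1` is in column `i`. -/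
def renewalMatrix (i j : ℕ) : ℕ := if i = 0 ∨ i = j + 1 then 1 else 0

/-- The ultragraph of the Renewal shift. The vertex `v_{i+1}` is the number `i`. The edge `e` is the
number `0`, with `s(e) = v_1` and `r(e) = {v_1, v_2, …}`; the edge `f_i`, `i ≥ 1`, is the number `i`,
with `s(f_i) = v_{i+1}` and `r(f_i) = {v_i}`. -/
def graph : Ultragraph ℕ ℕ :=
  Ultragraph.ofMatrix renewalMatrix fun i => ⟨i - 1, by
    unfold renewalMatrix; rw [if_pos (by omega)]⟩

theorem graph_s (i : ℕ) : graph.s i = i := rfl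

theorem graph_r_zero : graph.r 0 = Set.univ := by
  ext j; simp [graph, Ultragraph.ofMatrix, renewalMatrix]

theorem graph_r_succ (i : ℕ) : graph.r (i + 1) = {i} := by
  ext j
  show (if i + 1 = 0 ∨ i + 1 = j + 1 then 1 else 0) = 1 ↔ j = i
  by_cases h : i + 1 = 0 ∨ i + 1 = j + 1
  · rw [if_pos h]
    exact ⟨fun _ => by omega, fun _ => rfl⟩
  · rw [if_neg h]
    exact ⟨fun h0 => by omega, fun h0 => by omega⟩

/-- The space `X` of the Renewal shift. -/
abbrev Space : Type := graph.ShiftSpace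

/-- The shift map of the Renewal shift. -/
abbrev σ : Space →. Space := graph.shift

/-- The set of edges `F = {e, f_1, …, f_m}`. -/
def edgeSet (m : ℕ) : Set ℕ := Set.Iic m

/-- The family `α^m` of cylinder sets: `D_{(r(e),r(e)),F}`; the sets `D_{β,F}` for the finite paths
`β` with edges in `F`, whose last edge is `e` and `|β| < m`; and the sets `D_γ` for the finite
paths `γ` with edges in `F` and `|γ| = m`. Here `β` stands for the ultrapath `(β, r(β))`. -/
def cover (m : ℕ) : Set (Set Space) :=
  {graph.cylDiff [] (graph.r 0) (edgeSet m)} ∪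
  {D | ∃ β : List ℕ, graph.IsPath β ∧ (∀ a ∈ β, a ∈ edgeSet m) ∧ β.getLast? = some 0 ∧
      β.length < m ∧ D = graph.cylDiff β (graph.r 0) (edgeSet m)} ∪
  {D | ∃ (γ : List ℕ) (a : ℕ), graph.IsPath γ ∧ (∀ b ∈ γ, b ∈ edgeSet m) ∧ γ.length = m ∧
      γ.getLast? = some a ∧ D = graph.cyl γ (graph.r a)}

end Renewal

namespace Renewal

open Ultragraph

theorem mem_graph_r {a b : ℕ} : b ∈ graph.r a ↔ a = 0 ∨ a = b + 1 := by
  cases a with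
  | zero => simp [graph_r_zero]
  | succ a => simp [graph_r_succ, eq_comm]

/-! ### Minimal infinite emitters -/

theorem genSet_univ : graph.GenSet univ := graph_r_zero ▸ GenSet.range 0

theorem genSet_finite_or_eq_univ {A : Set ℕ} (hA : graph.GenSet A) : A.Finite ∨ A = univ := by
  induction hA with
  | vertex v => exact Or.inl (finite_singleton v)
  | range e =>
    cases e with
    | zero => exact Or.inr graph_r_zero
    | succ e => exact Or.inl (graph_r_succ e ▸ finite_singleton e)
  | union _ _ hA hB =>
    rcases hA with hA | rfl
    · rcases hB with hB | rfl
      · exact Or.inl (hA.union hB)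
      · exact Or.inr (union_univ _)
    · exact Or.inr (univ_union _)
  | inter _ _ _ hA hB =>
    rcases hA with hA | rfl
    · exact Or.inl (hA.subset inter_subset_left)
    · rwa [univ_inter]

theorem isMinInfEmitter_iff {A : Set ℕ} : graph.IsMinInfEmitter A ↔ A = univ := by
  constructor
  · rintro ⟨hA, hinf, -⟩
    exact (genSet_finite_or_eq_univ hA).resolve_left hinf
  · rintro rfl
    refine ⟨genSet_univ, infinite_univ, fun B hB hlt => ?_⟩
    rcases genSet_finite_or_eq_univ hB with h | rfl
    · exact not_infinite.2 h
    · exact absurd hlt (ssubset_irrefl _)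

/-! ### Edges of points -/

theorem edge?_succ_ne_none {x : Space} {i : ℕ} (h : x.edge? (i + 1) ≠ none) :
    x.edge? i ≠ none := by
  cases x with
  | inf γ hγ => simp [ShiftSpace.edge?]
  | fin p hp =>
    simp only [ShiftSpace.edge?, ne_eq, List.getElem?_eq_none_iff, not_le] at h ⊢
    omega

theorem edge?_ne_none_of_le {x : Space} {i j : ℕ} (hij : i ≤ j) (h : x.edge? j ≠ none) :
    x.edge? i ≠ none := by
  induction j, hij using Nat.le_induction with
  | base => exact h
  | succ j _ ih => exact ih (edge?_succ_ne_none h)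

theorem edge?_mem_range {x : Space} {i a b : ℕ} (ha : x.edge? i = some a)
    (hb : x.edge? (i + 1) = some b) : b ∈ graph.r a := by
  cases x with
  | inf γ hγ =>
    simp only [ShiftSpace.edge?, Option.some.injEq] at ha hb
    exact ha ▸ hb ▸ hγ i
  | fin p hp =>
    simp only [ShiftSpace.edge?] at ha hb
    obtain ⟨h1, rfl⟩ := List.getElem?_eq_some_iff.1 ha
    obtain ⟨h2, rfl⟩ := List.getElem?_eq_some_iff.1 hb
    exact List.isChain_iff_getElem.1 p.isPath i h2

theorem edge?_succ_of_pos {x : Space} {i a : ℕ} (ha : x.edge? i = some (a + 1)) :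
    x.edge? (i + 1) = some a := by
  rcases hb : x.edge? (i + 1) with _ | b
  · cases x with
    | inf γ hγ => simp [ShiftSpace.edge?] at hb
    | fin p hp =>
      simp only [ShiftSpace.edge?] at ha hb
      have hlast : p.edges.getLast? = some (a + 1) := by
        obtain ⟨h1, -⟩ := List.getElem?_eq_some_iff.1 ha
        have h2 := List.getElem?_eq_none_iff.1 hb
        rw [List.getLast?_eq_getElem?, ← ha]
        congr 1
        omega
      have hsub := p.rng_subset _ hlast
      rw [isMinInfEmitter_iff.1 hp, graph_r_succ] at hsub
      have := hsub (mem_univ (a + 1))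
      simp at this
  · have := edge?_mem_range ha hb
    rw [mem_graph_r] at this
    simp only [Option.some.injEq]
    omega

theorem edge?_add {x : Space} {i a j : ℕ} (ha : x.edge? i = some a) (hj : j ≤ a) :
    x.edge? (i + j) = some (a - j) := by
  induction j with
  | zero => simpa using ha
  | succ j ih =>
    have h := ih (by omega)
    rw [show a - j = a - (j + 1) + 1 by omega] at h
    exact edge?_succ_of_pos h

theorem space_ext {x y : Space} (h : ∀ i, x.edge? i = y.edge? i) : x = y := by
  have none_of_fin : ∀ p hp, (ShiftSpace.fin p hp : Space).edge? p.edges.length = none := by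
    simp [ShiftSpace.edge?]
  cases x with
  | inf γ hγ =>
    cases y with
    | inf δ hδ =>
      have : γ = δ := funext fun i => Option.some.inj (h i)
      subst this
      rfl
    | fin q hq =>
      have := (h q.edges.length).trans (none_of_fin q hq)
      simp [ShiftSpace.edge?] at this
  | fin p hp =>
    cases y with
    | inf δ hδ =>
      have := (h p.edges.length).symm.trans (none_of_fin p hp)
      simp [ShiftSpace.edge?] at this
    | fin q hq =>
      have h1 : p.edges = q.edges := List.ext_getElem? h
      have h2 : p.rng = q.rng :=
        (isMinInfEmitter_iff.1 hp).trans (isMinInfEmitter_iff.1 hq).symm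
      cases p
      cases q
      cases h1
      cases h2
      rfl

/-! ### The binary coding -/

/-- The binary sequence of a point `x`, which marks the positions of the edge `e`. -/
def binary (x : Space) (i : ℕ) : Bool := decide (x.edge? i = some 0)

theorem binary_eq_true {x : Space} {i : ℕ} : binary x i = true ↔ x.edge? i = some 0 := by
  simp [binary]

theorem edge?_eq_some_iff {x : Space} {i a : ℕ} :
    x.edge? i = some a ↔ binary x (i + a) = true ∧ ∀ j < a, binary x (i + j) = false := by
  constructor
  · intro h
    refine ⟨by rw [binary_eq_true, edge?_add h le_rfl, Nat.sub_self], fun j hj => ?_⟩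
    rw [binary, edge?_add h hj.le, decide_eq_false_iff_not, Option.some.injEq]
    omega
  · rintro ⟨h1, h2⟩
    rw [binary_eq_true] at h1
    obtain ⟨c, hc⟩ := Option.ne_none_iff_exists'.1
      (edge?_ne_none_of_le (Nat.le_add_right i a) (x := x) (by simp [h1]))
    rcases lt_trichotomy c a with h | rfl | h
    · have h3 := h2 c h
      rw [binary, edge?_add hc le_rfl] at h3
      simp at h3
    · exact hc
    · rw [edge?_add hc h.le, Option.some.injEq] at h1
      omega

theorem binary_injective : Function.Injective binary := by
  intro x y h
  refine space_ext fun i => Option.ext fun a => ?_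
  simp only [edge?_eq_some_iff, h]

/-- The number of zeros of `b` that precede its first one at or after position `i`. -/
noncomputable def gap (b : ℕ → Bool) (i : ℕ) : ℕ := sInf {k | b (i + k) = true}

theorem gap_spec {b : ℕ → Bool} {i j : ℕ} (hij : i ≤ j) (hj : b j = true) :
    b (i + gap b i) = true :=
  Nat.sInf_mem (s := {k | b (i + k) = true}) ⟨j - i, by simpa [Nat.add_sub_cancel' hij] using hj⟩

theorem gap_le {b : ℕ → Bool} {i k : ℕ} (h : b (i + k) = true) : gap b i ≤ k :=
  Nat.sInf_le h

theorem gap_eq_zero {b : ℕ → Bool} {i : ℕ} (h : b i = true) : gap b i = 0 :=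
  Nat.le_zero.1 (gap_le h)

theorem gap_succ_mem {b : ℕ → Bool} {i j : ℕ} (hij : i + 1 ≤ j) (hj : b j = true) :
    gap b (i + 1) ∈ graph.r (gap b i) := by
  rw [mem_graph_r]
  by_cases h0 : gap b i = 0
  · exact Or.inl h0
  refine Or.inr ?_
  have h1 := gap_spec (by omega) hj (i := i)
  have h2 := gap_spec hij hj
  have h3 : gap b (i + 1) ≤ gap b i - 1 := gap_le (by
    rwa [show i + 1 + (gap b i - 1) = i + gap b i by omega])
  have h4 : gap b i ≤ gap b (i + 1) + 1 := gap_le (by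
    rwa [show i + (gap b (i + 1) + 1) = i + 1 + gap b (i + 1) by omega])
  omega

theorem binary_surjective : Function.Surjective binary := by
  intro b
  have gap_iff : ∀ i j, i ≤ j → b j = true → (gap b i = 0 ↔ b i = true) := fun i j hij hj =>
    ⟨fun h => by simpa [h] using gap_spec hij hj, gap_eq_zero⟩
  by_cases hinf : ∀ n, ∃ k, n ≤ k ∧ b k = true
  · refine ⟨.inf (gap b) fun i => ?_, funext fun i => ?_⟩
    · obtain ⟨k, hk, hb⟩ := hinf (i + 1)
      exact gap_succ_mem hk hb
    · obtain ⟨k, hk, hb⟩ := hinf i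
      rw [Bool.eq_iff_iff, binary_eq_true]
      simpa [ShiftSpace.edge?] using gap_iff i k hk hb
  · classical
    push Not at hinf
    have hex : ∃ n, ∀ k, n ≤ k → b k = false := by simpa using hinf
    let N := Nat.find hex
    have hN : ∀ k, N ≤ k → b k = false := Nat.find_spec hex
    have hlast : ∀ n, n < N → n ≤ N - 1 ∧ b (N - 1) = true := fun n hn => by
      refine ⟨by omega, ?_⟩
      by_contra hb
      refine Nat.find_min hex (m := N - 1) (show N - 1 < N by omega) fun k hk => ?_
      rcases hk.eq_or_lt with rfl | hk
      · simpa using hb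
      · exact hN k (by omega)
    refine ⟨.fin ⟨(List.range N).map (gap b), univ, ?_, genSet_univ, ?_⟩
      (isMinInfEmitter_iff.2 rfl), funext fun i => ?_⟩
    · refine List.isChain_iff_getElem.2 fun i hi => ?_
      simp only [List.length_map, List.length_range] at hi
      simp only [List.getElem_map, List.getElem_range]
      exact gap_succ_mem (hlast _ hi).1 (hlast _ hi).2
    · intro e he
      rw [List.getLast?_eq_getElem?] at he
      simp only [List.length_map, List.length_range, List.getElem?_map, Option.mem_def,
        Option.map_eq_some_iff] at he
      obtain ⟨k, hk, rfl⟩ := he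
      obtain ⟨h1, rfl⟩ := List.getElem?_eq_some_iff.1 hk
      simp only [List.length_range] at h1
      rw [List.getElem_range, gap_eq_zero (hlast _ h1).2, graph_r_zero]
    · rw [Bool.eq_iff_iff, binary_eq_true]
      simp only [ShiftSpace.edge?, List.getElem?_map, Option.map_eq_some_iff]
      by_cases hi : i < N
      · simpa [hi] using gap_iff i _ (hlast i hi).1 (hlast i hi).2
      · simp [hi, hN i (not_lt.1 hi)]

/-! ### Cylinder sets -/

theorem cyl_univ (β : List ℕ) : graph.cyl β univ = {x | x.StartsWith β} := by
  ext x
  constructor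
  · rintro (⟨p, h, rfl, rfl, -⟩ | ⟨e, he, -⟩)
    · exact fun i _ => rfl
    · intro i hi
      rw [he i (by simp; omega), List.getElem?_append_left hi]
  · intro hx
    rcases hn : x.edge? β.length with _ | e
    · left
      cases x with
      | inf γ hγ => simp [ShiftSpace.edge?] at hn
      | fin p h =>
        refine ⟨p, h, rfl, ?_, subset_univ _⟩
        have hn' : p.edges.length ≤ β.length := List.getElem?_eq_none_iff.1 hn
        refine List.ext_getElem? fun i => ?_
        by_cases hi : i < β.length
        · exact hx i hi
        · rw [List.getElem?_eq_none (by omega), List.getElem?_eq_none (by omega)]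
    · right
      refine ⟨e, fun i hi => ?_, mem_univ _⟩
      rw [List.length_append, List.length_singleton] at hi
      by_cases h : i < β.length
      · rw [List.getElem?_append_left h, hx i h]
      · obtain rfl : i = β.length := by omega
        simp [hn]

theorem startsWith_append_singleton {x : Space} {β : List ℕ} {e : ℕ} :
    x.StartsWith (β ++ [e]) ↔ x.StartsWith β ∧ x.edge? β.length = some e := by
  constructor
  · intro h
    refine ⟨fun i hi => ?_, ?_⟩
    · rw [h i (by simp; omega), List.getElem?_append_left hi]
    · rw [h _ (by simp)]
      simp
  · rintro ⟨h1, h2⟩ i hi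
    rw [List.length_append, List.length_singleton] at hi
    by_cases h : i < β.length
    · rw [List.getElem?_append_left h, h1 i h]
    · obtain rfl : i = β.length := by omega
      simp [h2]

theorem cyl_of_finite (β : List ℕ) {B : Set ℕ} (hB : B.Finite) :
    graph.cyl β B = {x | x.StartsWith β ∧ ∃ e ∈ B, x.edge? β.length = some e} := by
  ext x
  simp only [cyl, startsWith_append_singleton, mem_union, mem_ofPred_eq, graph_s]
  constructor
  · rintro (⟨p, h, -, -, hp⟩ | ⟨e, ⟨h1, h2⟩, he⟩)
    · rw [isMinInfEmitter_iff.1 h] at hp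
      exact absurd (hB.subset hp) infinite_univ
    · exact ⟨h1, e, he, h2⟩
  · rintro ⟨h1, e, he, h2⟩
    exact Or.inr ⟨e, ⟨h1, h2⟩, he⟩

theorem cyl_range {β : List ℕ} {a : ℕ} (ha : β.getLast? = some a) :
    graph.cyl β (graph.r a) = {x | x.StartsWith β} := by
  cases a with
  | zero => rw [graph_r_zero, cyl_univ]
  | succ a =>
    rw [graph_r_succ, cyl_of_finite β (finite_singleton a)]
    ext x
    simp only [mem_singleton_iff, exists_eq_left, mem_ofPred_eq, and_iff_left_iff_imp]
    intro hx
    rw [List.getLast?_eq_getElem?] at ha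
    obtain ⟨h1, -⟩ := List.getElem?_eq_some_iff.1 ha
    have h2 := edge?_succ_of_pos ((hx _ h1).trans ha)
    rwa [Nat.sub_add_cancel (by omega)] at h2

theorem cylDiff_univ (β : List ℕ) (F : Set ℕ) :
    graph.cylDiff β univ F = {x | x.StartsWith β ∧ ∀ e ∈ F, x.edge? β.length ≠ some e} := by
  ext x
  constructor
  · rintro (⟨p, h, rfl, rfl, -⟩ | ⟨e, he, -, heF⟩)
    · exact ⟨fun i _ => rfl, fun e _ => by simp [ShiftSpace.edge?]⟩
    · rw [startsWith_append_singleton] at he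
      refine ⟨he.1, fun e' he' h => heF ?_⟩
      rw [he.2, Option.some.injEq] at h
      rwa [h]
  · rintro ⟨h1, h2⟩
    have h3 : x ∈ graph.cyl β univ := by rwa [cyl_univ]
    rcases h3 with ⟨p, h, rfl, rfl, -⟩ | ⟨e, he, -⟩
    · exact Or.inl ⟨p, h, rfl, rfl, isMinInfEmitter_iff.1 h⟩
    · exact Or.inr ⟨e, he, mem_univ _, fun hF => h2 e hF (startsWith_append_singleton.1 he).2⟩

/-! ### The homeomorphism with the Cantor space -/

theorem isPath_of_startsWith {x : Space} {β : List ℕ} (h : x.StartsWith β) :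
    graph.IsPath β := by
  refine List.isChain_iff_getElem.2 fun i hi => ?_
  refine edge?_mem_range (x := x) (i := i) ?_ ?_
  · rw [h i (by omega), List.getElem?_eq_getElem]
  · rw [h (i + 1) hi, List.getElem?_eq_getElem hi]
    rfl

theorem genSet_range (a : ℕ) : graph.GenSet (graph.r a) := GenSet.range a

/-- The ultrapath `(β, r(β))` of a path `β` with last edge `a`. -/
def fullUltrapath (β : List ℕ) (a : ℕ) (hβ : graph.IsPath β) (ha : β.getLast? = some a) :
    graph.Ultrapath where
  edges := β
  rng := graph.r a
  isPath := hβ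
  genSet := genSet_range a
  rng_subset := by
    intro e he
    rw [ha, Option.mem_some_iff] at he
    rw [he]

theorem exists_startsWith_of_edge? {x : Space} {i a : ℕ} (h : x.edge? i = some a) :
    ∃ β : List ℕ, β.length = i + 1 ∧ β.getLast? = some a ∧ x.StartsWith β := by
  induction i generalizing a with
  | zero => exact ⟨[a], rfl, rfl, fun j hj => by simp at hj; simp [hj, h]⟩
  | succ i ih =>
    obtain ⟨b, hb⟩ := Option.ne_none_iff_exists'.1
      (edge?_succ_ne_none (x := x) (i := i) (by simp [h]))
    obtain ⟨β, h1, -, h3⟩ := ih hb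
    exact ⟨β ++ [a], by simp [h1], by simp, startsWith_append_singleton.2 ⟨h3, by rw [h1, h]⟩⟩

theorem isOpen_startsWith_of_getLast? {β : List ℕ} {a : ℕ} (ha : β.getLast? = some a) :
    IsOpen {x : Space | x.StartsWith β} := by
  rcases eq_empty_or_nonempty {x : Space | x.StartsWith β} with h | ⟨x, hx⟩
  · rw [h]
    exact isOpen_empty
  · rw [← cyl_range ha]
    refine TopologicalSpace.isOpen_generateFrom_of_mem (Or.inl
      ⟨fullUltrapath β a (isPath_of_startsWith hx) ha, ?_, rfl⟩)
    rintro h0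
    replace h0 : β = [] := h0
    simp [h0] at ha

theorem isOpen_cylDiff {β : List ℕ} (hβ : graph.IsPath β) (hlast : ∀ e ∈ β.getLast?, e = 0)
    {F : Set ℕ} (hF : F.Finite) : IsOpen (graph.cylDiff β univ F) :=
  TopologicalSpace.isOpen_generateFrom_of_mem (Or.inr
    ⟨⟨β, univ, hβ, genSet_univ, fun e he => by rw [hlast e he, graph_r_zero]⟩, F,
      isMinInfEmitter_iff.2 rfl, fun _ _ => mem_univ _, hF, rfl⟩)

theorem continuous_binary : Continuous binary := by
  refine continuous_pi fun i => continuous_iff_continuousAt.2 fun x => ?_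
  rw [ContinuousAt, nhds_discrete Bool, tendsto_pure]
  rcases hx : x.edge? i with _ | a
  · cases x with
    | inf γ hγ => simp [ShiftSpace.edge?] at hx
    | fin p hp =>
      have hp' := isMinInfEmitter_iff.1 hp
      have hlast : ∀ e ∈ p.edges.getLast?, e = 0 := by
        intro e he
        have := p.rng_subset e he
        rw [hp'] at this
        simpa [mem_graph_r] using this (mem_univ e)
      have hlen : p.edges.length ≤ i := List.getElem?_eq_none_iff.1 hx
      refine Filter.mem_of_superset ((isOpen_cylDiff p.isPath hlast (finite_Iic i)).mem_nhds
        (Or.inl ⟨p, hp, rfl, rfl, hp'⟩)) fun y hy => ?_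
      rw [cylDiff_univ] at hy
      have hxf : binary (.fin p hp) i = false := by
        rw [binary, hx]
        rfl
      show binary y i = _
      rw [hxf, binary, decide_eq_false_iff_not]
      intro hyi
      obtain ⟨b, hb⟩ := Option.ne_none_iff_exists'.1
        (edge?_ne_none_of_le hlen (x := y) (by simp [hyi]))
      have hbi : i < b := not_le.1 fun h => hy.2 b h hb
      have := edge?_add hb (j := i - p.edges.length) (by omega)
      rw [Nat.add_sub_cancel' hlen, hyi, Option.some.injEq] at this
      omega
  · obtain ⟨β, h1, h2, h3⟩ := exists_startsWith_of_edge? hx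
    refine Filter.mem_of_superset ((isOpen_startsWith_of_getLast? h2).mem_nhds h3) fun y hy => ?_
    show binary y i = binary x i
    rw [binary, binary, hy i (by omega), h3 i (by omega)]

theorem isClopen_edge?_induced (i a : ℕ) :
    @IsClopen Space (.induced binary inferInstance) {x : Space | x.edge? i = some a} := by
  let _ : TopologicalSpace Space := TopologicalSpace.induced binary inferInstance
  have hc : Continuous binary := continuous_induced_dom
  have hb : ∀ j v, IsClopen {x : Space | binary x j = v} := fun j v =>
    (isClopen_discrete ({v} : Set Bool)).preimage ((continuous_apply j).comp hc)
  have : {x : Space | x.edge? i = some a} =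
      {x | binary x (i + a) = true} ∩ ⋂ j ∈ Finset.range a, {x | binary x (i + j) = false} := by
    ext x
    simp [edge?_eq_some_iff]
  rw [this]
  exact (hb _ _).inter (isClopen_biInter_finset fun j _ => hb _ _)

theorem isClopen_startsWith_induced (β : List ℕ) :
    @IsClopen Space (.induced binary inferInstance) {x : Space | x.StartsWith β} := by
  let _ : TopologicalSpace Space := TopologicalSpace.induced binary inferInstance
  have : {x : Space | x.StartsWith β} =
      ⋂ i : Fin β.length, {x : Space | x.edge? i = some β[i]} := by
    ext x
    simp only [mem_iInter, mem_ofPred_eq]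
    exact ⟨fun h i => by rw [h i i.2]; simp, fun h i hi => by
      have := h ⟨i, hi⟩
      rw [List.getElem?_eq_getElem hi]
      exact this⟩
  rw [this]
  exact isClopen_iInter_of_finite fun i => isClopen_edge?_induced i _

theorem isClopen_cyl_induced (β : List ℕ) {B : Set ℕ} (hB : graph.GenSet B) :
    @IsClopen Space (.induced binary inferInstance) (graph.cyl β B) := by
  let _ : TopologicalSpace Space := TopologicalSpace.induced binary inferInstance
  rcases genSet_finite_or_eq_univ hB with hB | rfl
  · have : graph.cyl β B =
        {x | x.StartsWith β} ∩ ⋃ e ∈ B, {x : Space | x.edge? β.length = some e} := by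
      rw [cyl_of_finite β hB]
      ext x
      simp
    rw [this]
    exact (isClopen_startsWith_induced β).inter
      (hB.isClopen_biUnion fun e _ => isClopen_edge?_induced _ e)
  · rw [cyl_univ]
    exact isClopen_startsWith_induced β

theorem isOpen_cylDiff_induced (β : List ℕ) {F : Set ℕ} (hF : F.Finite) :
    @IsOpen Space (.induced binary inferInstance) (graph.cylDiff β univ F) := by
  let _ : TopologicalSpace Space := TopologicalSpace.induced binary inferInstance
  have : graph.cylDiff β univ F =
      {x | x.StartsWith β} ∩ ⋂ e ∈ F, {x : Space | x.edge? β.length = some e}ᶜ := by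
    rw [cylDiff_univ]
    ext x
    simp
  rw [this]
  exact (isClopen_startsWith_induced β).isOpen.inter
    (hF.isOpen_biInter fun e _ => (isClopen_edge?_induced _ e).compl.isOpen)

theorem isInducing_binary : IsInducing binary := by
  refine ⟨le_antisymm continuous_binary.le_induced (le_generateFrom ?_)⟩
  rintro _ (⟨p, -, rfl⟩ | ⟨p, F, hp, -, hF, rfl⟩)
  · exact (isClopen_cyl_induced _ p.genSet).2
  · rw [isMinInfEmitter_iff.1 hp]
    exact isOpen_cylDiff_induced _ hF

/-- The binary coding identifies the space of the Renewal shift with the Cantor space. -/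
noncomputable def binaryHomeomorph : Space ≃ₜ (ℕ → Bool) :=
  (Equiv.ofBijective binary ⟨binary_injective, binary_surjective⟩).toHomeomorphOfIsInducing
    isInducing_binary

theorem binaryHomeomorph_apply (x : Space) : binaryHomeomorph x = binary x := rfl

theorem binary_symm_apply (b : ℕ → Bool) : binary (binaryHomeomorph.symm b) = b :=
  binaryHomeomorph.apply_symm_apply b

theorem compactSpace_space : CompactSpace Space := binaryHomeomorph.symm.compactSpace

theorem t2Space_space : T2Space Space := binaryHomeomorph.symm.t2Space

theorem isClopen_cyl (β : List ℕ) {B : Set ℕ} (hB : graph.GenSet B) :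
    IsClopen (graph.cyl β B) := by
  have h := isClopen_cyl_induced β hB
  rwa [← isInducing_binary.eq_induced] at h

/-! ### The shift map -/

/-- The extension of the shift map to all of `X` that fixes the point of length zero. -/
def totalShift : Space → Space
  | .inf γ h => .inf (fun i => γ (i + 1)) fun i => h (i + 1)
  | .fin p h => .fin p.tail h

theorem edge?_totalShift (x : Space) (i : ℕ) : (totalShift x).edge? i = x.edge? (i + 1) := by
  cases x with
  | inf γ h => rfl
  | fin p h => simp [totalShift, ShiftSpace.edge?, Ultrapath.tail]

theorem edge?_totalShift_iterate (x : Space) (n i : ℕ) :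
    (totalShift^[n] x).edge? i = x.edge? (n + i) := by
  induction n generalizing i with
  | zero => simp
  | succ n ih =>
    rw [Function.iterate_succ_apply', edge?_totalShift, ih]
    congr 1
    omega

theorem binary_totalShift (x : Space) (i : ℕ) :
    binary (totalShift x) i = binary x (i + 1) := by
  rw [binary, binary, edge?_totalShift]

theorem binary_totalShift_iterate (x : Space) (n i : ℕ) :
    binary (totalShift^[n] x) i = binary x (n + i) := by
  rw [binary, binary, edge?_totalShift_iterate]

theorem mem_dom_shift {x : Space} : x ∈ σ.Dom ↔ x.edge? 0 ≠ none := by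
  cases x with
  | inf γ h => exact iff_of_true trivial (by simp [ShiftSpace.edge?])
  | fin p h =>
    show p.edges ≠ [] ↔ _
    simp [ShiftSpace.edge?]

theorem mem_shift {x y : Space} : y ∈ σ x ↔ x.edge? 0 ≠ none ∧ y = totalShift x := by
  rw [← mem_dom_shift]
  cases x with
  | inf γ h =>
    exact ⟨fun hy => ⟨trivial, Part.mem_some_iff.1 hy⟩, fun hy => Part.mem_some_iff.2 hy.2⟩
  | fin p h =>
    exact ⟨fun ⟨h1, h2⟩ => ⟨h1, h2.symm⟩, fun ⟨h1, h2⟩ => ⟨h1, h2.symm⟩⟩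

theorem mem_preim {n : ℕ} {x : Space} {A : Set Space} :
    x ∈ DRSystem.preim σ n A ↔ (∀ i < n, x.edge? i ≠ none) ∧ totalShift^[n] x ∈ A := by
  induction n generalizing A with
  | zero => simp [DRSystem.preim]
  | succ n ih =>
    show x ∈ DRSystem.preim σ n (σ.preimage A) ↔ _
    simp only [ih, PFun.mem_preimage, mem_shift, edge?_totalShift_iterate, add_zero,
      Function.iterate_succ_apply', Nat.forall_lt_succ_right]
    constructor
    · rintro ⟨h1, y, hy, h2, rfl⟩
      exact ⟨⟨h1, h2⟩, hy⟩
    · rintro ⟨⟨h1, h2⟩, hy⟩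
      exact ⟨h1, _, hy, h2, rfl⟩

theorem isOpen_dom_shift : IsOpen σ.Dom := by
  have := t2Space_space
  have h : σ.Dom = {binaryHomeomorph.symm fun _ => false}ᶜ := by
    ext x
    rw [mem_dom_shift, mem_compl_iff, mem_singleton_iff, not_iff_not]
    constructor
    · intro h
      refine binaryHomeomorph.injective (funext fun i => ?_)
      rw [binaryHomeomorph.apply_symm_apply, binaryHomeomorph_apply, binary,
        decide_eq_false_iff_not]
      intro hi
      exact edge?_ne_none_of_le (Nat.zero_le i) (x := x) (by simp [hi]) h
    · rintro rfl
      refine Option.eq_none_iff_forall_ne_some.2 fun a ha => ?_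
      simpa [binary_symm_apply] using (edge?_eq_some_iff.1 ha).1
  rw [h]
  exact isOpen_compl_singleton

/-- The binary sequence `v b₀ b₁ …`. -/
def consSeq (v : Bool) (b : ℕ → Bool) : ℕ → Bool
  | 0 => v
  | i + 1 => b i

/-- The shift of binary sequences is invertible on the sequences with a given first entry. -/
def consPartialHomeomorph (v : Bool) : OpenPartialHomeomorph (ℕ → Bool) (ℕ → Bool) where
  toFun b i := b (i + 1)
  invFun := consSeq v
  source := (fun b => b 0) ⁻¹' {v}
  target := univ
  map_source' _ _ := mem_univ _
  map_target' _ _ := rfl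
  left_inv' b hb := by
    funext i
    cases i with
    | zero => exact hb.symm
    | succ i => rfl
  right_inv' _ _ := rfl
  open_source := (isOpen_discrete ({v} : Set Bool)).preimage (continuous_apply (0 : ℕ))
  open_target := isOpen_univ
  continuousOn_toFun := (continuous_pi fun i => continuous_apply (i + 1)).continuousOn
  continuousOn_invFun := (continuous_pi fun i => by
    cases i with
    | zero => exact continuous_const
    | succ i => exact continuous_apply i).continuousOn

theorem isLocalHomeomorph_shift : IsLocalHomeomorph σ.asSubtype := by
  have h1 : IsLocalHomeomorph fun (b : ℕ → Bool) i => b (i + 1) :=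
    IsLocalHomeomorph.mk _ fun b => ⟨consPartialHomeomorph (b 0), rfl, fun _ _ => rfl⟩
  have h2 := binaryHomeomorph.symm.isLocalHomeomorph.comp ((h1.comp
    binaryHomeomorph.isLocalHomeomorph).comp
      isOpen_dom_shift.isOpenEmbedding_subtypeVal.isLocalHomeomorph)
  convert h2 using 1
  funext x
  have h3 : σ.asSubtype x = totalShift x := (mem_shift.1 (Part.get_mem _)).2
  rw [h3]
  refine binaryHomeomorph.injective (funext fun i => ?_)
  simp [binaryHomeomorph_apply, binary_totalShift]

theorem isDeaconuRenault : DRSystem.IsDeaconuRenault σ where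
  locallyCompact := by
    have := compactSpace_space
    have := t2Space_space
    infer_instance
  hausdorff := t2Space_space
  isOpen_dom := isOpen_dom_shift
  isLocalHomeomorph := isLocalHomeomorph_shift

end Renewal

namespace DRSystem

theorem coverLog_eq_log {X : Type*} {α : Set (Set X)} {Y : Set X} {c : ℕ}
    (hc : coverNumber α Y = c) : coverLog α Y = ((Real.log c : ℝ) : EReal) := by
  have h1 : (1 : ℕ∞) ≤ c := hc ▸ le_max_left _ _
  have h2 : (0 : ℝ) < c := by exact_mod_cast h1
  have h3 : ((c : ℕ∞) : ENNReal) = ENNReal.ofReal (c : ℝ) := by simp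
  rw [coverLog, hc, h3, ENNReal.log_ofReal_of_pos h2]

theorem tendsto_log_two_pow_mul_div {c : ℕ} (hc : c ≠ 0) :
    Tendsto (fun n : ℕ => ((Real.log ((2 ^ n * c : ℕ) : ℝ) : ℝ) : EReal) / (n : EReal)) atTop
      (𝓝 ((Real.log 2 : ℝ) : EReal)) := by
  have h1 : Tendsto (fun n : ℕ => Real.log 2 + Real.log c / n) atTop (𝓝 (Real.log 2)) := by
    simpa using (tendsto_const_div_atTop_nhds_zero_nat (Real.log c)).const_add (Real.log 2)
  refine ((continuous_coe_real_ereal.tendsto _).comp h1).congr'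
    ((eventually_ne_atTop 0).mono fun n hn => ?_)
  have hn' : (n : ℝ) ≠ 0 := by exact_mod_cast hn
  have hc' : (c : ℝ) ≠ 0 := by exact_mod_cast hc
  have h2 : Real.log ((2 ^ n * c : ℕ) : ℝ) / n = Real.log 2 + Real.log c / n := by
    rw [Nat.cast_mul, Nat.cast_pow, Nat.cast_ofNat, Real.log_mul (by positivity) hc',
      Real.log_pow]
    field_simp
  show ((Real.log 2 + Real.log c / n : ℝ) : EReal) = _
  rw [← h2, EReal.coe_div]
  rfl

theorem coverEntropy_eq_log_two {X : Type*} {α : Set (Set X)} {σ : X →. X} {K : Set X} {c : ℕ}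
    (h : ∀ n, coverNumber (iterJoin σ α n) (iterSet σ K n) = 2 ^ n * c) :
    coverEntropy α σ K = ((Real.log 2 : ℝ) : EReal) := by
  have hc : c ≠ 0 := by
    rintro rfl
    have : (1 : ℕ∞) ≤ _ := le_max_left _ _ |>.trans_eq (h 0)
    simp at this
  refine ((tendsto_log_two_pow_mul_div hc).congr fun n => ?_).limsup_eq
  rw [coverLog_eq_log (c := 2 ^ n * c) (by rw [h n]; push_cast; rfl)]

theorem coverEntropy_le_log_two {X : Type*} {α : Set (Set X)} {σ : X →. X} {K : Set X} {c : ℕ}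
    (hc : c ≠ 0) (h : ∀ n, coverNumber (iterJoin σ α n) (iterSet σ K n) ≤ 2 ^ n * c) :
    coverEntropy α σ K ≤ ((Real.log 2 : ℝ) : EReal) := by
  rw [← (tendsto_log_two_pow_mul_div hc).limsup_eq]
  refine limsup_le_limsup (Eventually.of_forall fun n => ?_)
  have h' : coverNumber (iterJoin σ α n) (iterSet σ K n) ≤ ((2 ^ n * c : ℕ) : ℕ∞) :=
    (h n).trans_eq (by push_cast; rfl)
  obtain ⟨k, hk⟩ := ENat.ne_top_iff_exists.1 (ne_top_of_le_ne_top (ENat.natCast_ne_top _) h')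
  have h1 : 1 ≤ k := by
    have : (1 : ℕ∞) ≤ k := hk ▸ le_max_left _ _
    exact_mod_cast this
  have h2 : k ≤ 2 ^ n * c := by
    rw [← hk] at h'
    exact_mod_cast h'
  dsimp only
  rw [coverLog_eq_log hk.symm]
  refine EReal.div_le_div_right_of_nonneg (by positivity) (EReal.coe_le_coe_iff.2 ?_)
  exact Real.log_le_log (by exact_mod_cast h1) (by exact_mod_cast h2)

theorem coverNumber_le_encard_image {X ι : Type*} {α : Set (Set X)} {Y : Set X} (g : X → ι)
    (h : ∀ x ∈ Y, ∃ C ∈ α, ∀ y ∈ Y, g y = g x → y ∈ C) :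
    coverNumber α Y ≤ max 1 (g '' Y).encard := by
  refine max_le_max le_rfl ?_
  choose! C hC hC' using h
  have h1 : ∀ l ∈ g '' Y, ∃ x ∈ Y, g x = l := fun l hl => hl
  rcases Y.eq_empty_or_nonempty with rfl | ⟨x₀, -⟩
  · exact (iInf₂_le ∅ ⟨empty_subset _, empty_subset _⟩).trans (by simp)
  have : Nonempty X := ⟨x₀⟩
  choose! f hf hf' using h1
  refine (iInf₂_le ((fun l => C (f l)) '' (g '' Y)) ⟨?_, fun y hy => ?_⟩).trans
    (encard_image_le _ _)
  · rintro _ ⟨l, hl, rfl⟩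
    exact hC _ (hf l hl)
  · have hl := mem_image_of_mem g hy
    exact ⟨_, ⟨_, hl, rfl⟩, hC' _ (hf _ hl) y hy (hf' _ hl).symm⟩

theorem encard_image_le_coverNumber {X ι : Type*} {α : Set (Set X)} {Y : Set X} (g : X → ι)
    (h : ∀ C ∈ α, ∀ x ∈ C, ∀ y ∈ C, g x = g y) :
    (g '' Y).encard ≤ coverNumber α Y := by
  refine le_trans (le_iInf₂ fun γ hγ => ?_) (le_max_right _ _)
  choose! C hC hC' using fun y (hy : y ∈ Y) => hγ.2 hy
  rcases Y.eq_empty_or_nonempty with rfl | ⟨y₀, -⟩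
  · simp
  have : Inhabited ι := ⟨g y₀⟩
  have hex : ∀ D : Set X, ∃ l : ι, D ∈ α → ∀ x ∈ D, g x = l := fun D => by
    rcases D.eq_empty_or_nonempty with rfl | ⟨x, hx⟩
    · exact ⟨default, by simp⟩
    · exact ⟨g x, fun hD y hy => h D hD y hy x hx⟩
  choose l hl using hex
  refine (encard_mono ?_).trans (encard_image_le l γ)
  rintro _ ⟨y, hy, rfl⟩
  exact ⟨C y, hC y hy, (hl _ (hγ.1 (hC y hy)) y (hC' y hy)).symm⟩

end DRSystem

namespace Renewal

open Ultragraph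

/-! ### Upper bound for the entropy -/

/-- The first `n` entries of the binary sequence of `x`. -/
def binaryPrefix (n : ℕ) (x : Space) (i : Fin n) : Bool := binary x i

theorem binaryPrefix_eq_iff {n : ℕ} {x y : Space} :
    binaryPrefix n x = binaryPrefix n y ↔ ∀ i < n, binary x i = binary y i :=
  ⟨fun h i hi => congrFun h ⟨i, hi⟩, fun h => funext fun i => h i i.2⟩

theorem exists_binaryPrefix_subset {x : Space} {U : Set Space} (hU : U ∈ 𝓝 x) :
    ∃ n, {y | binaryPrefix n y = binaryPrefix n x} ⊆ U := by
  rw [isInducing_binary.nhds_eq_comap, mem_comap] at hU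
  obtain ⟨V, hV, hVU⟩ := hU
  rw [nhds_pi, Filter.mem_pi] at hV
  obtain ⟨I, hI, t, ht, hsub⟩ := hV
  obtain ⟨N, hN⟩ := hI.bddAbove
  refine ⟨N + 1, fun y hy => hVU (hsub fun i hi => ?_)⟩
  show binary y i ∈ t i
  rw [binaryPrefix_eq_iff.1 hy i (Nat.lt_succ_of_le (hN hi))]
  exact mem_of_mem_nhds (ht i)

theorem isOpen_binaryPrefix_eq (n : ℕ) (x : Space) :
    IsOpen {y | binaryPrefix n y = binaryPrefix n x} := by
  have h : Continuous (binaryPrefix n) :=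
    continuous_pi fun i => (continuous_apply (i : ℕ)).comp continuous_binary
  exact (isOpen_discrete {binaryPrefix n x}).preimage h

theorem exists_uniform_binaryPrefix {K : Set Space} (hK : IsCompact K) {α : Set (Set Space)}
    (hα : DRSystem.IsOpenCover α K) :
    ∃ m, ∀ x ∈ K, ∃ A ∈ α, ∀ y, binaryPrefix m y = binaryPrefix m x → y ∈ A := by
  refine hK.induction_on (p := fun K => ∃ m, ∀ x ∈ K, ∃ A ∈ α, ∀ y,
    binaryPrefix m y = binaryPrefix m x → y ∈ A) ⟨0, by simp⟩ ?_ ?_ fun x hx => ?_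
  · rintro s t hst ⟨m, hm⟩
    exact ⟨m, fun x hx => hm x (hst hx)⟩
  · rintro s t ⟨m, hm⟩ ⟨m', hm'⟩
    refine ⟨max m m', ?_⟩
    rintro x (hx | hx)
    · obtain ⟨A, hA, h⟩ := hm x hx
      exact ⟨A, hA, fun y hy => h y (binaryPrefix_eq_iff.2 fun i hi =>
        binaryPrefix_eq_iff.1 hy i (lt_max_of_lt_left hi))⟩
    · obtain ⟨A, hA, h⟩ := hm' x hx
      exact ⟨A, hA, fun y hy => h y (binaryPrefix_eq_iff.2 fun i hi =>
        binaryPrefix_eq_iff.1 hy i (lt_max_of_lt_right hi))⟩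
  · obtain ⟨A, hA, hxA⟩ := hα.2 hx
    obtain ⟨m, hm⟩ := exists_binaryPrefix_subset ((hα.1 A hA).mem_nhds hxA)
    exact ⟨_, mem_nhdsWithin_of_mem_nhds ((isOpen_binaryPrefix_eq m x).mem_nhds rfl), m,
      fun z hz => ⟨A, hA, fun y hy => hm (hy.trans hz)⟩⟩

theorem exists_mem_iterJoin {K : Set Space} {α : Set (Set Space)} {m : ℕ}
    (hm : ∀ x ∈ K, ∃ A ∈ α, ∀ y, binaryPrefix m y = binaryPrefix m x → y ∈ A) (n : ℕ) :
    ∀ x ∈ DRSystem.iterSet σ K n, ∃ C ∈ DRSystem.iterJoin σ α n,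
      ∀ y ∈ DRSystem.iterSet σ K n,
        binaryPrefix (n + m) y = binaryPrefix (n + m) x → y ∈ C := by
  induction n with
  | zero =>
    intro x hx
    obtain ⟨A, hA, h⟩ := hm x hx
    exact ⟨A, hA, fun y _ hy => h y (by rwa [Nat.zero_add] at hy)⟩
  | succ n ih =>
    rintro x ⟨hx, hx'⟩
    obtain ⟨C, hC, h⟩ := ih x hx
    rw [mem_preim] at hx'
    obtain ⟨A, hA, h'⟩ := hm _ hx'.2
    refine ⟨_, ⟨C, hC, _, ⟨A, hA, rfl⟩, rfl⟩, fun y hy hxy => ?_⟩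
    rw [binaryPrefix_eq_iff] at hxy
    refine ⟨h y hy.1 (binaryPrefix_eq_iff.2 fun i hi => hxy i (by omega)), mem_preim.2
      ⟨(mem_preim.1 hy.2).1, h' _ (binaryPrefix_eq_iff.2 fun i hi => ?_)⟩⟩
    rw [binary_totalShift_iterate, binary_totalShift_iterate]
    exact hxy _ (by omega)

theorem coverEntropy_le {K : Set Space} (hK : IsCompact K) {α : Set (Set Space)}
    (hα : DRSystem.IsOpenCover α K) :
    DRSystem.coverEntropy α σ K ≤ ((Real.log 2 : ℝ) : EReal) := by
  obtain ⟨m, hm⟩ := exists_uniform_binaryPrefix hK hα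
  refine DRSystem.coverEntropy_le_log_two (c := 2 ^ m) (by positivity) fun n => ?_
  refine (DRSystem.coverNumber_le_encard_image _ (exists_mem_iterJoin hm n)).trans
    (max_le ?_ ?_)
  · rw [← Nat.cast_ofNat, ← Nat.cast_pow, ← Nat.cast_mul, ← Nat.cast_one, Nat.cast_le]
    exact Nat.one_le_iff_ne_zero.2 (by positivity)
  · refine (encard_le_encard (subset_univ _)).trans_eq ?_
    rw [encard_univ, ENat.card_eq_coe_fintype_card, Fintype.card_fun, Fintype.card_bool,
      Fintype.card_fin, pow_add]
    push_cast
    rfl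

/-! ### Cover numbers of partitions -/

theorem mem_iterSet_univ {n : ℕ} {x : Space} :
    x ∈ DRSystem.iterSet σ univ n ↔ ∀ i < n, x.edge? i ≠ none := by
  induction n with
  | zero => simp [DRSystem.iterSet]
  | succ n ih =>
    simp only [DRSystem.iterSet, mem_inter_iff, ih, mem_preim, mem_univ, and_true]
    exact ⟨fun h => h.2, fun h => ⟨fun i hi => h i (by omega), h⟩⟩

/-- The partition of `X` into the non-empty fibres of `f`. -/
def fibres {ι : Type*} (f : Space → ι) : Set (Set Space) := (fun l => f ⁻¹' {l}) '' range f

theorem mem_fibres {ι : Type*} (f : Space → ι) (x : Space) : f ⁻¹' {f x} ∈ fibres f :=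
  ⟨f x, mem_range_self x, rfl⟩

theorem encard_fibres {ι : Type*} (f : Space → ι) : (fibres f).encard = (range f).encard := by
  refine InjOn.encard_image ?_
  rintro _ ⟨x, rfl⟩ _ ⟨y, rfl⟩ h
  have : x ∈ f ⁻¹' {f y} := (Set.ext_iff.1 h x).1 rfl
  exact this

theorem pairwiseDisjoint_fibres {ι : Type*} (f : Space → ι) :
    (fibres f).PairwiseDisjoint id := by
  rintro _ ⟨l, -, rfl⟩ _ ⟨l', -, rfl⟩ h
  refine Set.disjoint_left.2 fun x hx hx' => h ?_
  obtain rfl : f x = l := hx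
  obtain rfl : f x = l' := hx'
  rfl

theorem isOpenCover_fibres {ι : Type*} {f : Space → ι} (hf : ∀ x, IsOpen (f ⁻¹' {f x})) :
    DRSystem.IsOpenCover (fibres f) univ := by
  refine ⟨?_, fun x _ => ⟨_, mem_fibres f x, rfl⟩⟩
  rintro _ ⟨_, ⟨x, rfl⟩, rfl⟩
  exact hf x

theorem eq_of_mem_iterJoin_fibres {ι : Type*} {f : Space → ι}
    (h1 : ∀ x y, f x = f y → binary x 0 = binary y 0) (n : ℕ) :
    ∀ C ∈ DRSystem.iterJoin σ (fibres f) n, ∀ x ∈ C, ∀ y ∈ C,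
      (binaryPrefix n x, f (totalShift^[n] x)) = (binaryPrefix n y, f (totalShift^[n] y)) := by
  induction n with
  | zero =>
    rintro _ ⟨l, -, rfl⟩ x hx y hy
    exact Prod.ext (funext fun i => i.elim0) (hx.trans hy.symm)
  | succ n ih =>
    rintro _ ⟨C, hC, _, ⟨_, ⟨l, -, rfl⟩, rfl⟩, rfl⟩ x hx y hy
    have h2 := Prod.ext_iff.1 (ih C hC x hx.1 y hy.1)
    refine Prod.ext (binaryPrefix_eq_iff.2 fun i hi => ?_)
      ((mem_preim.1 hx.2).2.trans (mem_preim.1 hy.2).2.symm)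
    rcases (Nat.lt_succ_iff.1 hi).lt_or_eq with hi | rfl
    · exact binaryPrefix_eq_iff.1 h2.1 i hi
    · simpa only [binary_totalShift_iterate, add_zero] using h1 _ _ h2.2

theorem exists_mem_iterJoin_fibres {ι : Type*} {f : Space → ι}
    (h2 : ∀ x y, binary x 0 = binary y 0 → f (totalShift x) = f (totalShift y) → f x = f y)
    (n : ℕ) : ∀ x ∈ DRSystem.iterSet σ univ n, ∃ C ∈ DRSystem.iterJoin σ (fibres f) n,
      ∀ y ∈ DRSystem.iterSet σ univ n,
        (binaryPrefix n y, f (totalShift^[n] y)) = (binaryPrefix n x, f (totalShift^[n] x)) →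
          y ∈ C := by
  induction n with
  | zero => exact fun x _ => ⟨_, mem_fibres f x, fun y _ hy => (Prod.ext_iff.1 hy).2⟩
  | succ n ih =>
    rintro x ⟨hx, hx'⟩
    obtain ⟨C, hC, h⟩ := ih x hx
    refine ⟨_, ⟨C, hC, _, ⟨_, mem_fibres f (totalShift^[n + 1] x), rfl⟩, rfl⟩, fun y hy hyx => ?_⟩
    obtain ⟨h3, h4⟩ := Prod.ext_iff.1 hyx
    have h5 := binaryPrefix_eq_iff.1 h3
    refine ⟨h y hy.1 (Prod.ext (binaryPrefix_eq_iff.2 fun i hi => h5 i (by omega)) (h2 _ _ ?_ ?_)),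
      mem_preim.2 ⟨(mem_preim.1 hy.2).1, h4⟩⟩
    · rw [binary_totalShift_iterate, binary_totalShift_iterate]
      exact h5 _ (by omega)
    · simpa only [Function.iterate_succ_apply'] using h4

theorem exists_mem_fibre_binary_eq_true {ι : Type*} {f : Space → ι}
    (hf : ∀ x, IsOpen (f ⁻¹' {f x})) (x : Space) : ∃ y k, f y = f x ∧ binary y k = true := by
  obtain ⟨n, hn⟩ := exists_binaryPrefix_subset ((hf x).mem_nhds rfl)
  let b : ℕ → Bool := fun i => if i < n then binary x i else true
  refine ⟨binaryHomeomorph.symm b, n, hn (binaryPrefix_eq_iff.2 fun i hi => ?_), ?_⟩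
  · rw [binary_symm_apply]
    exact if_pos hi
  · rw [binary_symm_apply]
    exact if_neg (lt_irrefl n)

theorem edge?_ne_none_of_binary {x : Space} {i k : ℕ} (hik : i ≤ k) (h : binary x k = true) :
    x.edge? i ≠ none :=
  edge?_ne_none_of_le hik (by simp [binary_eq_true.1 h])

theorem image_iterSet_univ {ι : Type*} {f : Space → ι} (hf : ∀ x, IsOpen (f ⁻¹' {f x})) (n : ℕ) :
    (fun x => (binaryPrefix n x, f (totalShift^[n] x))) '' DRSystem.iterSet σ univ n =
      univ ×ˢ range f := by
  ext ⟨w, l⟩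
  constructor
  · rintro ⟨x, -, h⟩
    exact ⟨mem_univ _, _, congrArg Prod.snd h⟩
  · rintro ⟨-, x, rfl⟩
    obtain ⟨y, k, hy, hk⟩ := exists_mem_fibre_binary_eq_true hf x
    let b : ℕ → Bool := fun i => if h : i < n then w ⟨i, h⟩ else binary y (i - n)
    have hb : ∀ i, b (n + i) = binary y i := fun i => by simp [b]
    refine ⟨binaryHomeomorph.symm b, mem_iterSet_univ.2 fun i hi =>
      edge?_ne_none_of_binary (k := n + k) (by omega) ?_, Prod.ext (funext fun i => ?_) ?_⟩
    · rw [binary_symm_apply, hb, hk]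
    · show binary _ i = w i
      rw [binary_symm_apply]
      exact dif_pos i.2
    · show f _ = f x
      rw [← hy]
      congr 1
      refine binary_injective (funext fun i => ?_)
      rw [binary_totalShift_iterate, binary_symm_apply, hb]

theorem coverNumber_iterJoin_fibres {ι : Type*} {f : Space → ι}
    (hf : ∀ x, IsOpen (f ⁻¹' {f x})) (h1 : ∀ x y, f x = f y → binary x 0 = binary y 0)
    (h2 : ∀ x y, binary x 0 = binary y 0 → f (totalShift x) = f (totalShift y) → f x = f y)
    (n : ℕ) :
    DRSystem.coverNumber (DRSystem.iterJoin σ (fibres f) n) (DRSystem.iterSet σ univ n) =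
      2 ^ n * (fibres f).encard := by
  have hcard : ((fun x => (binaryPrefix n x, f (totalShift^[n] x))) ''
      DRSystem.iterSet σ univ n).encard = 2 ^ n * (fibres f).encard := by
    rw [image_iterSet_univ hf, encard_prod, encard_fibres, encard_univ,
      ENat.card_eq_coe_fintype_card, Fintype.card_fun, Fintype.card_bool, Fintype.card_fin]
    push_cast
    rfl
  rw [← hcard]
  refine le_antisymm ((DRSystem.coverNumber_le_encard_image _
    (exists_mem_iterJoin_fibres h2 n)).trans (max_le ?_ le_rfl))
    (DRSystem.encard_image_le_coverNumber _ (eq_of_mem_iterJoin_fibres h1 n))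
  rw [one_le_encard_iff_nonempty, image_iterSet_univ hf]
  exact univ_nonempty.prod ⟨_, mem_range_self (binaryHomeomorph.symm fun _ => true)⟩

/-! ### The covers of the Renewal shift -/

open scoped Classical in
/-- The longest sequence of at most `k` edges in `edgeSet m` that `x` starts with. -/
noncomputable def truncation (m : ℕ) : ℕ → Space → List ℕ
  | 0, _ => []
  | k + 1, x =>
    if ∃ a ≤ m, x.edge? 0 = some a then (x.edge? 0).getD 0 :: truncation m k (totalShift x) else []

theorem truncation_succ_of_le {m k a : ℕ} {x : Space} (ha : a ≤ m) (h : x.edge? 0 = some a) :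
    truncation m (k + 1) x = a :: truncation m k (totalShift x) := by
  rw [truncation, if_pos ⟨a, ha, h⟩, h, Option.getD_some]

theorem truncation_succ_of_not {m k : ℕ} {x : Space} (h : ¬ ∃ a ≤ m, x.edge? 0 = some a) :
    truncation m (k + 1) x = [] := by
  rw [truncation, if_neg h]

theorem startsWith_cons {x : Space} {a : ℕ} {l : List ℕ} :
    x.StartsWith (a :: l) ↔ x.edge? 0 = some a ∧ (totalShift x).StartsWith l := by
  constructor
  · intro h
    refine ⟨h 0 (by simp), fun i hi => ?_⟩
    rw [edge?_totalShift, h (i + 1) (by simpa using hi), List.getElem?_cons_succ]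
  · rintro ⟨h1, h2⟩ i hi
    cases i with
    | zero => exact h1
    | succ i => rw [← edge?_totalShift, h2 i (by simpa using hi), List.getElem?_cons_succ]

theorem truncation_eq_iff {m k : ℕ} {x : Space} {l : List ℕ} :
    truncation m k x = l ↔ l.length ≤ k ∧ (∀ a ∈ l, a ≤ m) ∧ x.StartsWith l ∧
      (l.length < k → ∀ a ≤ m, x.edge? l.length ≠ some a) := by
  induction k generalizing x l with
  | zero =>
    simp only [truncation, Nat.le_zero, List.length_eq_zero_iff]
    constructor
    · rintro rfl
      exact ⟨rfl, by simp, fun i hi => by simp at hi, by simp⟩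
    · exact fun h => h.1.symm
  | succ k ih =>
    cases l with
    | nil =>
      have h0 : x.StartsWith [] := fun i hi => by simp at hi
      simp only [List.length_nil, Nat.zero_le, List.not_mem_nil, false_imp_iff, implies_true,
        h0, true_and, Nat.succ_pos, forall_true_left]
      constructor
      · intro h a ha hx
        rw [truncation_succ_of_le ha hx] at h
        exact List.cons_ne_nil _ _ h
      · intro h
        exact truncation_succ_of_not fun ⟨a, ha, hx⟩ => h a ha hx
    | cons b l =>
      by_cases h : ∃ a ≤ m, x.edge? 0 = some a
      · obtain ⟨a, ha, hx⟩ := h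
        rw [truncation_succ_of_le ha hx, List.cons.injEq, ih, startsWith_cons, hx]
        simp only [List.length_cons, List.mem_cons, forall_eq_or_imp, edge?_totalShift,
          Option.some.injEq, Nat.add_le_add_iff_right, Nat.add_lt_add_iff_right]
        constructor
        · rintro ⟨rfl, h1, h2, h3, h4⟩
          exact ⟨h1, ⟨ha, h2⟩, ⟨rfl, h3⟩, h4⟩
        · rintro ⟨h1, ⟨-, h2⟩, ⟨rfl, h3⟩, h4⟩
          exact ⟨rfl, h1, h2, h3, h4⟩
      · rw [truncation_succ_of_not h]
        refine iff_of_false (List.cons_ne_nil _ _).symm ?_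
        rintro ⟨-, h2, h3, -⟩
        exact h ⟨b, h2 b (by simp), (startsWith_cons.1 h3).1⟩

theorem binary_eq_false_of_not {m i : ℕ} {x : Space} (h : ¬ ∃ a ≤ m, x.edge? 0 = some a)
    (hi : i ≤ m) : binary x i = false := by
  induction i using Nat.strong_induction_on with
  | _ i ih =>
    by_contra hb
    refine h ⟨i, hi, edge?_eq_some_iff.2 ⟨?_, fun j hj => ?_⟩⟩
    · simpa using hb
    · rw [Nat.zero_add]
      exact ih j hj (by omega)

theorem binary_eq_of_truncation_eq {m k : ℕ} (hk : k ≤ m) {x y : Space}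
    (h : truncation m k x = truncation m k y) : ∀ i < k, binary x i = binary y i := by
  induction k generalizing x y with
  | zero => simp
  | succ k ih =>
    by_cases hx : ∃ a ≤ m, x.edge? 0 = some a
    · obtain ⟨a, ha, hxa⟩ := hx
      rw [truncation_succ_of_le ha hxa] at h
      by_cases hy : ∃ b ≤ m, y.edge? 0 = some b
      · obtain ⟨b, hb, hyb⟩ := hy
        rw [truncation_succ_of_le hb hyb, List.cons.injEq] at h
        obtain ⟨rfl, h⟩ := h
        intro i hi
        cases i with
        | zero => rw [binary, binary, hxa, hyb]
        | succ i =>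
          rw [← binary_totalShift, ← binary_totalShift]
          exact ih (by omega) h i (by omega)
      · rw [truncation_succ_of_not hy] at h
        exact absurd h (List.cons_ne_nil _ _)
    · by_cases hy : ∃ b ≤ m, y.edge? 0 = some b
      · obtain ⟨b, hb, hyb⟩ := hy
        rw [truncation_succ_of_le hb hyb, truncation_succ_of_not hx] at h
        exact absurd h.symm (List.cons_ne_nil _ _)
      · intro i hi
        rw [binary_eq_false_of_not hx (by omega), binary_eq_false_of_not hy (by omega)]

theorem truncation_take {m k : ℕ} {x y : Space}
    (h : truncation m (k + 1) x = truncation m (k + 1) y) :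
    truncation m k x = truncation m k y := by
  obtain ⟨h1, h2, h3, h4⟩ := truncation_eq_iff.1 h
  obtain ⟨-, -, h3', h4'⟩ := truncation_eq_iff.1 (rfl : truncation m (k + 1) y = _)
  set l := truncation m (k + 1) y
  have key : ∀ z : Space, z.StartsWith l → (l.length < k + 1 → ∀ a ≤ m,
      z.edge? l.length ≠ some a) → truncation m k z = l.take k := by
    intro z hz hz'
    refine truncation_eq_iff.2 ⟨List.length_take_le _ _, fun a ha => h2 a (List.mem_of_mem_take ha),
      fun i hi => ?_, fun hlt => ?_⟩
    · rw [List.length_take] at hi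
      rw [hz i (by omega), List.getElem?_take_of_lt (by omega)]
    · rw [List.length_take] at hlt ⊢
      rw [min_eq_right (by omega)]
      exact hz' (by omega)
  rw [key x h3 h4, key y h3' h4']

theorem edge?_zero_of_binary_false {x : Space} (h : binary x 0 = false) (a : ℕ) :
    x.edge? 0 = some a ↔ ∃ c, a = c + 1 ∧ (totalShift x).edge? 0 = some c := by
  constructor
  · intro ha
    cases a with
    | zero => simp [binary, ha] at h
    | succ c => exact ⟨c, rfl, by rw [edge?_totalShift]; exact edge?_succ_of_pos ha⟩
  · rintro ⟨c, rfl, hc⟩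
    rw [edge?_eq_some_iff] at hc ⊢
    simp only [binary_totalShift, Nat.zero_add] at hc ⊢
    refine ⟨hc.1, fun j hj => ?_⟩
    cases j with
    | zero => exact h
    | succ j => exact hc.2 j (by omega)

theorem truncation_eq_of_totalShift {m k : ℕ} {x y : Space} (h0 : binary x 0 = binary y 0)
    (h : truncation m (k + 1) (totalShift x) = truncation m (k + 1) (totalShift y)) :
    truncation m (k + 1) x = truncation m (k + 1) y := by
  have hstep : ∀ a ≤ m, x.edge? 0 = some a → y.edge? 0 = some a →
      truncation m (k + 1) x = truncation m (k + 1) y := fun a ha hx hy => by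
    rw [truncation_succ_of_le ha hx, truncation_succ_of_le ha hy, truncation_take h]
  rcases hx0 : binary x 0 with _ | _
  · have hx := edge?_zero_of_binary_false hx0
    have hy := edge?_zero_of_binary_false (h0 ▸ hx0)
    have transfer : ∀ {u v : Space},
        truncation m (k + 1) (totalShift u) = truncation m (k + 1) (totalShift v) →
        ∀ c, c + 1 ≤ m → (totalShift u).edge? 0 = some c → (totalShift v).edge? 0 = some c := by
      intro u v huv c hc hu
      rw [truncation_succ_of_le (by omega) hu] at huv
      exact (startsWith_cons.1 (truncation_eq_iff.1 huv.symm).2.2.1).1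
    by_cases hxe : ∃ a ≤ m, x.edge? 0 = some a
    · obtain ⟨a, ha, hxa⟩ := hxe
      obtain ⟨c, rfl, hc⟩ := (hx a).1 hxa
      exact hstep _ ha hxa ((hy _).2 ⟨c, rfl, transfer h c ha hc⟩)
    · by_cases hye : ∃ a ≤ m, y.edge? 0 = some a
      · obtain ⟨a, ha, hya⟩ := hye
        obtain ⟨c, rfl, hc⟩ := (hy a).1 hya
        exact hstep _ ha ((hx _).2 ⟨c, rfl, transfer h.symm c ha hc⟩) hya
      · rw [truncation_succ_of_not hxe, truncation_succ_of_not hye]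
  · exact hstep 0 (Nat.zero_le m) (binary_eq_true.1 hx0) (binary_eq_true.1 (h0 ▸ hx0))

theorem exists_startsWith {β : List ℕ} (hβ : graph.IsPath β) : ∃ x : Space, x.StartsWith β := by
  have hprep : ∀ (v : Bool) (y : Space), ∃ x, totalShift x = y ∧ binary x 0 = v := fun v y =>
    ⟨binaryHomeomorph.symm (consSeq v (binary y)),
      binary_injective (funext fun i => by rw [binary_totalShift, binary_symm_apply]; rfl),
      by rw [binary_symm_apply]; rfl⟩
  have hcons : ∀ (a : ℕ) (y : Space), (∀ c, a = c + 1 → y.edge? 0 = some c) →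
      ∃ x, totalShift x = y ∧ x.edge? 0 = some a := by
    intro a y hy
    cases a with
    | zero =>
      obtain ⟨x, h1, h2⟩ := hprep true y
      exact ⟨x, h1, binary_eq_true.1 h2⟩
    | succ c =>
      obtain ⟨x, h1, h2⟩ := hprep false y
      exact ⟨x, h1, (edge?_zero_of_binary_false h2 _).2 ⟨c, rfl, h1 ▸ hy c rfl⟩⟩
  have hstart : ∀ a : ℕ, ∃ x : Space, x.edge? 0 = some a := by
    intro a
    induction a with
    | zero =>
      obtain ⟨x, -, hx⟩ := hcons 0 (binaryHomeomorph.symm fun _ => true) (by simp)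
      exact ⟨x, hx⟩
    | succ a ih =>
      obtain ⟨y, hy⟩ := ih
      obtain ⟨x, -, hx⟩ := hcons (a + 1) y (by rintro c ⟨⟩; exact hy)
      exact ⟨x, hx⟩
  have hnil : ∀ x : Space, x.StartsWith [] := fun x i hi => by simp at hi
  induction β with
  | nil => exact ⟨binaryHomeomorph.symm fun _ => true, hnil _⟩
  | cons a l ih =>
    cases l with
    | nil =>
      obtain ⟨x, hx⟩ := hstart a
      exact ⟨x, startsWith_cons.2 ⟨hx, hnil _⟩⟩
    | cons b l =>
      obtain ⟨hab, hl⟩ := List.isChain_cons_cons.1 hβ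
      obtain ⟨y, hy⟩ := ih hl
      obtain ⟨x, rfl, hx⟩ := hcons a y (by
        rintro c rfl
        rw [graph_r_succ, mem_singleton_iff] at hab
        replace hab : b = c := hab
        exact hab ▸ (startsWith_cons.1 hy).1)
      exact ⟨x, startsWith_cons.2 ⟨hx, hy⟩⟩

theorem fibre_truncation_of_lt {m : ℕ} {β : List ℕ} (h1 : β.length < m) (h2 : ∀ a ∈ β, a ≤ m) :
    truncation m m ⁻¹' {β} = graph.cylDiff β univ (edgeSet m) := by
  ext x
  rw [mem_preimage, mem_singleton_iff, truncation_eq_iff, cylDiff_univ]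
  exact ⟨fun h => ⟨h.2.2.1, h.2.2.2 h1⟩, fun h => ⟨h1.le, h2, h.1, fun _ => h.2⟩⟩

theorem fibre_truncation_of_eq {m a : ℕ} {γ : List ℕ} (h1 : γ.length = m) (h2 : ∀ a ∈ γ, a ≤ m)
    (ha : γ.getLast? = some a) : truncation m m ⁻¹' {γ} = graph.cyl γ (graph.r a) := by
  ext x
  rw [mem_preimage, mem_singleton_iff, truncation_eq_iff, cyl_range ha]
  exact ⟨fun h => h.2.2.1, fun h => ⟨h1.le, h2, h, fun h => absurd h1 h.ne⟩⟩

theorem cylDiff_univ_nonempty {β : List ℕ} (hβ : graph.IsPath β) (h0 : ∀ e ∈ β.getLast?, e = 0)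
    (F : Set ℕ) : (graph.cylDiff β univ F).Nonempty :=
  ⟨.fin ⟨β, univ, hβ, genSet_univ, fun e he => by rw [h0 e he, graph_r_zero]⟩
    (isMinInfEmitter_iff.2 rfl), Or.inl ⟨_, isMinInfEmitter_iff.2 rfl, rfl, rfl, rfl⟩⟩

theorem getLast?_of_startsWith {m : ℕ} {x : Space} {l : List ℕ} (hl : ∀ a ∈ l, a ≤ m)
    (hx : x.StartsWith l) (h : ∀ a ≤ m, x.edge? l.length ≠ some a) :
    ∀ e ∈ l.getLast?, e = 0 := by
  intro e he
  have hel := hl e (List.mem_of_getLast? he)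
  cases e with
  | zero => rfl
  | succ e =>
    rw [Option.mem_def, List.getLast?_eq_getElem?] at he
    obtain ⟨h1, -⟩ := List.getElem?_eq_some_iff.1 he
    have h2 := edge?_succ_of_pos ((hx _ h1).trans he)
    rw [Nat.sub_add_cancel (by omega)] at h2
    exact absurd h2 (h e (by omega))

theorem cover_eq_fibres {m : ℕ} (hm : 1 ≤ m) : cover m = fibres (truncation m m) := by
  have hmem : ∀ l, (truncation m m ⁻¹' {l}).Nonempty →
      truncation m m ⁻¹' {l} ∈ fibres (truncation m m) := by
    rintro _ ⟨x, rfl⟩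
    exact mem_fibres _ x
  apply Subset.antisymm
  · rintro D ((h | ⟨β, h1, h2, h3, h4, rfl⟩) | ⟨γ, a, h1, h2, h3, h4, rfl⟩)
    · obtain rfl : D = _ := h
      rw [graph_r_zero, ← fibre_truncation_of_lt (Nat.lt_of_succ_le hm) (by simp)]
      apply hmem
      rw [fibre_truncation_of_lt (Nat.lt_of_succ_le hm) (by simp)]
      exact cylDiff_univ_nonempty List.isChain_nil (by simp) _
    · rw [graph_r_zero, ← fibre_truncation_of_lt h4 h2]
      apply hmem
      rw [fibre_truncation_of_lt h4 h2]
      exact cylDiff_univ_nonempty h1 (by simp [h3]) _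
    · rw [← fibre_truncation_of_eq h3 h2 h4]
      apply hmem
      rw [fibre_truncation_of_eq h3 h2 h4, cyl_range h4]
      exact exists_startsWith h1
  · rintro _ ⟨_, ⟨x, rfl⟩, rfl⟩
    obtain ⟨h1, h2, h3, h4⟩ := truncation_eq_iff.1 (rfl : truncation m m x = _)
    set l := truncation m m x
    have hpath := isPath_of_startsWith h3
    rcases h1.lt_or_eq with h1 | h1
    · have hlast := getLast?_of_startsWith h2 h3 (h4 h1)
      left
      show truncation m m ⁻¹' {l} ∈ _
      rw [fibre_truncation_of_lt h1 h2, ← graph_r_zero]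
      rcases hl : l.getLast? with _ | e
      · left
        rw [List.getLast?_eq_none_iff] at hl
        rw [hl]
        rfl
      · right
        obtain rfl := hlast e hl
        exact ⟨l, hpath, h2, hl, h1, rfl⟩
    · right
      rcases hl : l.getLast? with _ | e
      · rw [List.getLast?_eq_none_iff] at hl
        rw [hl] at h1
        simp at h1
        omega
      · exact ⟨l, e, hpath, h2, h1, hl, fibre_truncation_of_eq h1 h2 hl⟩

theorem isOpen_fibre_truncation {m : ℕ} (hm : 1 ≤ m) (x : Space) :
    IsOpen (truncation m m ⁻¹' {truncation m m x}) := by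
  obtain ⟨h1, h2, h3, h4⟩ := truncation_eq_iff.1 (rfl : truncation m m x = _)
  rcases h1.lt_or_eq with h1 | h1
  · rw [fibre_truncation_of_lt h1 h2]
    exact isOpen_cylDiff (isPath_of_startsWith h3) (getLast?_of_startsWith h2 h3 (h4 h1))
      (finite_Iic m)
  · rcases hl : (truncation m m x).getLast? with _ | e
    · rw [List.getLast?_eq_none_iff] at hl
      simp [hl] at h1
      omega
    · rw [fibre_truncation_of_eq h1 h2 hl, cyl_range hl]
      exact isOpen_startsWith_of_getLast? hl

theorem isOpenCover_cover {m : ℕ} (hm : 1 ≤ m) : DRSystem.IsOpenCover (cover m) univ := by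
  rw [cover_eq_fibres hm]
  exact isOpenCover_fibres (isOpen_fibre_truncation hm)

theorem coverNumber_iterJoin_cover {m : ℕ} (hm : 1 ≤ m) (n : ℕ) :
    DRSystem.coverNumber (DRSystem.iterJoin σ (cover m) n) (DRSystem.iterSet σ univ n) =
      2 ^ n * (cover m).encard := by
  rw [cover_eq_fibres hm]
  refine coverNumber_iterJoin_fibres (isOpen_fibre_truncation hm)
    (fun x y h => binary_eq_of_truncation_eq le_rfl h 0 hm) (fun x y h0 h => ?_) n
  obtain ⟨k, rfl⟩ := Nat.exists_eq_add_of_le' hm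
  exact truncation_eq_of_totalShift h0 h

theorem finite_cover {m : ℕ} (hm : 1 ≤ m) : (cover m).Finite := by
  have := compactSpace_space
  have h := DRSystem.coverNumber_ne_top isCompact_univ (isOpenCover_cover hm)
  have h0 := coverNumber_iterJoin_cover hm 0
  rw [pow_zero, one_mul] at h0
  exact encard_ne_top_iff.1 (h0 ▸ h)

theorem coverEntropy_cover {m : ℕ} (hm : 1 ≤ m) :
    DRSystem.coverEntropy (cover m) σ univ = ((Real.log 2 : ℝ) : EReal) := by
  obtain ⟨c, hc⟩ := ENat.ne_top_iff_exists.1 (encard_ne_top_iff.2 (finite_cover hm))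
  exact DRSystem.coverEntropy_eq_log_two (c := c) fun n => by
    rw [coverNumber_iterJoin_cover hm, hc]

theorem relEntropy_le {K : Set Space} (hK : IsCompact K) :
    DRSystem.relEntropy σ K ≤ ((Real.log 2 : ℝ) : EReal) :=
  iSup₂_le fun _ hα => coverEntropy_le hK hα

theorem relEntropy_univ : DRSystem.relEntropy σ univ = ((Real.log 2 : ℝ) : EReal) := by
  have := compactSpace_space
  refine le_antisymm (relEntropy_le isCompact_univ) ?_
  rw [← coverEntropy_cover le_rfl]
  exact le_iSup₂ (f := fun (α : Set (Set Space)) (_ : DRSystem.IsOpenCover α univ) =>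
    DRSystem.coverEntropy α σ univ) (cover 1) (isOpenCover_cover le_rfl)

theorem topEntropy_eq : DRSystem.topEntropy σ = ((Real.log 2 : ℝ) : EReal) := by
  have := compactSpace_space
  refine le_antisymm (iSup₂_le fun K hK => relEntropy_le hK) ?_
  rw [← relEntropy_univ]
  exact le_iSup₂ (f := fun (K : Set Space) (_ : IsCompact K) => DRSystem.relEntropy σ K) univ
    isCompact_univ

end Renewal

namespace Ultragraph

variable {V E : Type*} [Countable V] [Countable E] {G : Ultragraph V E}

/-- Two points agree on the first `n` ultrapaths of the list `p`. -/
def AgreeOn (p : ℕ → G.Ultrapath) (n : ℕ) (x y : G.ShiftSpace) : Prop :=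
  ∀ i < n, ((p i).IsInitialSegment x ↔ (p i).IsInitialSegment y)

theorem pathDist_self (p : ℕ → G.Ultrapath) (x : G.ShiftSpace) : pathDist p x x = 0 := if_pos rfl

theorem pathDist_comm (p : ℕ → G.Ultrapath) (x y : G.ShiftSpace) :
    pathDist p x y = pathDist p y x := by
  by_cases h : x = y
  · rw [h]
  · rw [pathDist, pathDist, if_neg h, if_neg (Ne.symm h)]
    simp only [xor_comm]

/-- The ultrapaths of the list `p` separate the points of `X`. -/
def Separating (p : ℕ → G.Ultrapath) : Prop :=
  ∀ x y : G.ShiftSpace, (∀ i, (p i).IsInitialSegment x ↔ (p i).IsInitialSegment y) → x = y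

theorem pathDist_le_iff {p : ℕ → G.Ultrapath} (hp : Separating p) {n : ℕ} {x y : G.ShiftSpace} :
    pathDist p x y ≤ (1 / 2) ^ (n + 1) ↔ AgreeOn p n x y := by
  by_cases hxy : x = y
  · subst hxy
    rw [pathDist_self]
    exact iff_of_true (by positivity) fun _ _ => Iff.rfl
  have hne : {i | Xor ((p i).IsInitialSegment x) ((p i).IsInitialSegment y)}.Nonempty := by
    by_contra h
    refine hxy (hp x y fun i => ?_)
    by_contra hi
    exact h ⟨i, (xor_iff_not_iff _ _).2 hi⟩
  rw [pathDist, if_neg hxy,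
    pow_le_pow_iff_right_of_lt_one₀ (by norm_num) (by norm_num), Nat.add_le_add_iff_right]
  constructor
  · intro h i hi
    by_contra hx
    exact Nat.notMem_of_lt_sInf (hi.trans_le h) ((xor_iff_not_iff _ _).2 hx)
  · intro h
    by_contra hlt
    exact (xor_iff_not_iff _ _).1 (Nat.sInf_mem hne) (h _ (not_le.1 hlt))

theorem pathDist_eq_zero {p : ℕ → G.Ultrapath} {x y : G.ShiftSpace}
    (h : pathDist p x y = 0) : x = y := by
  by_contra hxy
  rw [pathDist, if_neg hxy] at h
  exact absurd h (by positivity)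

theorem pathDist_nonneg (p : ℕ → G.Ultrapath) (x y : G.ShiftSpace) : 0 ≤ pathDist p x y := by
  rw [pathDist]
  split_ifs
  · exact le_rfl
  · positivity

theorem pathDist_le_max {p : ℕ → G.Ultrapath} (hp : Separating p) (x y z : G.ShiftSpace) :
    pathDist p x z ≤ max (pathDist p x y) (pathDist p y z) := by
  by_cases hxy : x = y
  · rw [hxy]
    exact le_max_right _ _
  by_cases hyz : y = z
  · rw [hyz]
    exact le_max_left _ _
  obtain ⟨k, hk⟩ : ∃ k, pathDist p x y = (1 / 2) ^ (k + 1) := ⟨_, if_neg hxy⟩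
  obtain ⟨l, hl⟩ : ∃ l, pathDist p y z = (1 / 2) ^ (l + 1) := ⟨_, if_neg hyz⟩
  have h1 := (pathDist_le_iff hp).1 hk.le
  have h2 := (pathDist_le_iff hp).1 hl.le
  have key : ∀ n, n ≤ k → n ≤ l → pathDist p x z ≤ (1 / 2) ^ (n + 1) := fun n hn hn' =>
    (pathDist_le_iff hp).2 fun i hi =>
      (h1 i (hi.trans_le hn)).trans (h2 i (hi.trans_le hn'))
  rcases le_total k l with h | h
  · exact (key k le_rfl h).trans (hk ▸ le_max_left _ _)
  · exact (key l h le_rfl).trans (hl ▸ le_max_right _ _)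

theorem isClopen_agreeOn {p : ℕ → G.Ultrapath}
    (hc : ∀ i, IsClopen {x | (p i).IsInitialSegment x}) (n : ℕ) (x : G.ShiftSpace) :
    IsClopen {y | AgreeOn p n x y} := by
  have : {y | AgreeOn p n x y} = ⋂ i ∈ Finset.range n,
      {y | (p i).IsInitialSegment x ↔ (p i).IsInitialSegment y} := by
    ext y
    simp [AgreeOn]
  rw [this]
  refine isClopen_biInter_finset fun i _ => ?_
  by_cases h : (p i).IsInitialSegment x
  · simpa only [h, true_iff] using hc i
  · simp only [h, false_iff]
    exact (hc i).compl

theorem exists_agreeOn_subset [CompactSpace G.ShiftSpace] {p : ℕ → G.Ultrapath}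
    (hp : Separating p) (hc : ∀ i, IsClopen {x | (p i).IsInitialSegment x})
    {U : Set G.ShiftSpace} (hU : IsOpen U) {x : G.ShiftSpace} (hx : x ∈ U) :
    ∃ n, {y | AgreeOn p n x y} ⊆ U := by
  obtain ⟨n, hn⟩ := exists_subset_nhds_of_isCompact'
    (V := fun n => {y | AgreeOn p n x y})
    (directed_of_isDirected_le fun a b hab y (hy : AgreeOn p b x y) i hi =>
      hy i (hi.trans_le hab))
    (fun n => (isClopen_agreeOn hc n x).isClosed.isCompact)
    (fun n => (isClopen_agreeOn hc n x).isClosed) (U := U) (by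
      intro y hy
      obtain rfl : x = y := hp x y fun i => mem_iInter.1 hy (i + 1) i (Nat.lt_succ_self i)
      exact hU.mem_nhds hx)
  exact ⟨n, hn⟩

theorem exists_metricSpace_pathDist [CompactSpace G.ShiftSpace] {p : ℕ → G.Ultrapath}
    (hp : Separating p) (hc : ∀ i, IsClopen {x | (p i).IsInitialSegment x}) :
    ∃ M : MetricSpace G.ShiftSpace,
      M.toPseudoMetricSpace.toUniformSpace.toTopologicalSpace = G.shiftTopology ∧
      ∀ x y, M.toPseudoMetricSpace.toDist.dist x y = pathDist p x y := by
  refine ⟨MetricSpace.ofDistTopology (pathDist p) (pathDist_self p) (pathDist_comm p)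
    (fun x y z => (pathDist_le_max hp x y z).trans
      (max_le_add_of_nonneg (pathDist_nonneg p x y) (pathDist_nonneg p y z)))
    (fun U => ⟨fun hU x hx => ?_, fun h => ?_⟩) (fun x y => pathDist_eq_zero), rfl,
    fun x y => rfl⟩
  · obtain ⟨n, hn⟩ := exists_agreeOn_subset hp hc hU hx
    exact ⟨(1 / 2) ^ (n + 1), by positivity, fun y hy => hn ((pathDist_le_iff hp).1 hy.le)⟩
  · refine isOpen_iff_mem_nhds.2 fun x hx => ?_
    obtain ⟨ε, hε, h⟩ := h x hx
    obtain ⟨n, hn⟩ := exists_pow_lt_of_lt_one hε (by norm_num : (1 / 2 : ℝ) < 1)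
    refine Filter.mem_of_superset ((isClopen_agreeOn hc n x).isOpen.mem_nhds
      fun _ _ => Iff.rfl) fun y hy => h y ?_
    refine ((pathDist_le_iff hp).2 hy).trans_lt (lt_of_le_of_lt ?_ hn)
    exact pow_le_pow_of_le_one (by norm_num) (by norm_num) (Nat.le_succ n)

end Ultragraph

namespace Renewal

open Ultragraph

theorem isClopen_isInitialSegment (p : graph.Ultrapath) :
    IsClopen {x | p.IsInitialSegment x} :=
  isClopen_cyl p.edges p.genSet

theorem fullUltrapath_mem_basicUltrapaths {β : List ℕ} {a : ℕ} (hβ : graph.IsPath β)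
    (ha : β.getLast? = some a) : fullUltrapath β a hβ ha ∈ graph.basicUltrapaths := by
  cases a with
  | zero => exact Or.inr (isMinInfEmitter_iff.2 graph_r_zero)
  | succ a => exact Or.inl ⟨a, graph_r_succ a⟩

theorem separating_of_basicUltrapaths_subset {p : ℕ → graph.Ultrapath}
    (hp : graph.basicUltrapaths ⊆ range p) : Separating p := by
  have key : ∀ x y : Space, (∀ i, (p i).IsInitialSegment x ↔ (p i).IsInitialSegment y) →
      ∀ i a, x.edge? i = some a → y.edge? i = some a := by
    intro x y h i a hx
    obtain ⟨β, h1, h2, h3⟩ := exists_startsWith_of_edge? hx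
    obtain ⟨j, hj⟩ := hp (fullUltrapath_mem_basicUltrapaths (isPath_of_startsWith h3) h2)
    have hj' : ∀ z : Space, (p j).IsInitialSegment z ↔ z.StartsWith β := fun z => by
      rw [hj, Ultrapath.IsInitialSegment]
      show z ∈ graph.cyl β (graph.r a) ↔ _
      rw [cyl_range h2]
      rfl
    have h4 := (hj' y).1 ((h j).1 ((hj' x).2 h3))
    rw [h4 i (by omega), ← h3 i (by omega), hx]
  intro x y h
  exact space_ext fun i => Option.ext fun a =>
    ⟨key x y h i a, key y x (fun i => (h i).symm) i a⟩

theorem separating {p : ℕ → graph.Ultrapath}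
    (hp : range p = graph.basicUltrapaths ∨ range p = univ) : Separating p := by
  apply separating_of_basicUltrapaths_subset
  rcases hp with hp | hp
  · exact hp.ge
  · exact hp ▸ subset_univ _

theorem exists_coverDiam_cover_le {p : ℕ → graph.Ultrapath} (hp : Separating p) (n : ℕ) :
    ∃ M, ∀ m ≥ M, DRSystem.coverDiam (pathDist p) (cover m) ≤
      ENNReal.ofReal ((1 / 2) ^ (n + 1)) := by
  have := compactSpace_space
  obtain ⟨M, hM⟩ := exists_uniform_binaryPrefix (K := univ) isCompact_univ
    (α := range fun x => {y | AgreeOn p n x y}) ⟨by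
      rintro _ ⟨x, rfl⟩
      exact (isClopen_agreeOn (fun i => isClopen_isInitialSegment (p i)) n x).isOpen,
      fun x _ => ⟨_, mem_range_self x, fun _ _ => Iff.rfl⟩⟩
  refine ⟨M + 1, fun m hm => iSup₂_le fun A hA => iSup₂_le fun x hx => iSup₂_le fun y hy => ?_⟩
  rw [cover_eq_fibres (by omega)] at hA
  obtain ⟨l, -, rfl⟩ := hA
  have hxy := binary_eq_of_truncation_eq le_rfl (Eq.trans hy (Eq.symm hx))
  obtain ⟨_, ⟨z, rfl⟩, hz⟩ := hM x (mem_univ x)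
  have h1 : AgreeOn p n z x := hz x rfl
  have h2 : AgreeOn p n z y := hz y (binaryPrefix_eq_iff.2 fun i hi => hxy i (by omega))
  exact ENNReal.ofReal_le_ofReal ((pathDist_le_iff hp).2 fun i hi =>
    (h1 i hi).symm.trans (h2 i hi))

theorem tendsto_coverDiam_cover {p : ℕ → graph.Ultrapath} (hp : Separating p) :
    Tendsto (fun m => DRSystem.coverDiam (pathDist p) (cover m)) atTop (𝓝 0) := by
  refine ENNReal.tendsto_nhds_zero.2 fun ε hε => ?_
  have h1 : Tendsto (fun n : ℕ => ENNReal.ofReal ((1 / 2) ^ (n + 1))) atTop (𝓝 0) := by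
    have := (tendsto_pow_atTop_nhds_zero_of_lt_one (r := (1 / 2 : ℝ)) (by norm_num)
      (by norm_num)).comp (tendsto_add_atTop_nat 1)
    simpa using ENNReal.tendsto_ofReal this
  obtain ⟨n, hn⟩ := (ENNReal.tendsto_nhds_zero.1 h1 ε hε).exists
  obtain ⟨M, hM⟩ := exists_coverDiam_cover_le hp n
  exact (eventually_ge_atTop M).mono fun m hm => (hM m hm).trans hn

end Renewal

theorem mainTheorem9 :
    -- the system is a Deaconu-Renault system on a compact space
    CompactSpace Renewal.Space ∧
    DRSystem.IsDeaconuRenault Renewal.σ ∧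
    -- its topological entropy is `log 2`
    DRSystem.topEntropy Renewal.σ = ((Real.log 2 : ℝ) : EReal) ∧
    DRSystem.relEntropy Renewal.σ Set.univ = ((Real.log 2 : ℝ) : EReal) ∧
    -- the finite open covers `α^m` by pairwise disjoint cylinder sets
    (∀ m : ℕ, 1 ≤ m →
      (Renewal.cover m).Finite ∧
      DRSystem.IsOpenCover (Renewal.cover m) Set.univ ∧
      (Renewal.cover m).PairwiseDisjoint id ∧
      (∀ n : ℕ, DRSystem.coverNumber (DRSystem.iterJoin Renewal.σ (Renewal.cover m) n)
          (DRSystem.iterSet Renewal.σ Set.univ n) = 2 ^ n * (Renewal.cover m).encard) ∧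
      DRSystem.coverEntropy (Renewal.cover m) Renewal.σ Set.univ = ((Real.log 2 : ℝ) : EReal)) ∧
    -- their diameters tend to zero for the metric given by any enumeration of `S` or of `𝔭`
    (∀ p : ℕ → Renewal.graph.Ultrapath, Function.Injective p →
      (Set.range p = Renewal.graph.basicUltrapaths ∨ Set.range p = Set.univ) →
      (∃ M : MetricSpace Renewal.Space,
        M.toPseudoMetricSpace.toUniformSpace.toTopologicalSpace =
          Renewal.graph.shiftTopology ∧
        ∀ x y, M.toPseudoMetricSpace.toDist.dist x y = Ultragraph.pathDist p x y) ∧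
      Filter.Tendsto (fun m => DRSystem.coverDiam (Ultragraph.pathDist p) (Renewal.cover m))
        Filter.atTop (nhds 0)) := by
  have := Renewal.compactSpace_space
  refine ⟨this, Renewal.isDeaconuRenault, Renewal.topEntropy_eq, Renewal.relEntropy_univ,
    fun m hm => ⟨Renewal.finite_cover hm, Renewal.isOpenCover_cover hm, ?_,
      Renewal.coverNumber_iterJoin_cover hm, Renewal.coverEntropy_cover hm⟩,
    fun p _ hp => ⟨Ultragraph.exists_metricSpace_pathDist (Renewal.separating hp)
      fun i => Renewal.isClopen_isInitialSegment (p i),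
      Renewal.tendsto_coverDiam_cover (Renewal.separating hp)⟩⟩
  rw [Renewal.cover_eq_fibres hm]
  exact Renewal.pairwiseDisjoint_fibres _
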